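/- Let $\mathcal M=(E,\mathcal I)$ be a matroid on $n=|E|$ elements; $\log$ denotes $\log_2$. For $G\subseteq E$ and a uniformly random permutation $\pi$ of $G$, let $C_\pi$ be the first circuit that appears when the elements of $G$ are added in the order $\pi$ (none if $G$ is independent; an event about $C_\pi$ includes that $C_\pi$ exists). For $T\subseteq G$ put $p_{T,\mathcal M|_G}=\Pr_\pi[T\cap C_\pi\neq\emptyset]$ and $p_{x,\mathcal M|_G}=p_{\{x\},\mathcal M|_G}$, and, for $G=E$, $q_{T,\mathcal M}=\Pr_\pi[C_\pi\subseteq T]$. A set $S\subseteq E$ is globally optimal if $q_{S,\mathcal M}\ge 1-2^{-20}$ and $p_{T,\mathcal M|_S}\ge \frac{|T|}{2^{21}|S|\log n}$ for every $T\subseteq S$. Let $\alpha(S)$ be the least $k$ such that a uniformly random $k$-element subset of $S$ is independent with probability at most $1/2$, let $\mathrm{CORE}_S=\{x\in S: p_{x,\mathcal M|_S}\ge \alpha(S)^2/|S|^2\}$, and let $\ell=\sum_{i\in S\setminus \mathrm{CORE}_S}p_{i,\mathcal M|_S}$. A set $D\subseteq S$ is a set of redundant elements of $S$ if every element of $D$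 lies in $\mathrm{span}(S\setminus D)$. There are absolute constants $c,k,n_0\in\mathbb N$ and $\delta,\varepsilon>0$ such that the following holds for every finite set $E$ with $n=|E|\ge n_0$ and every $S\subseteq E$. There is a randomized algorithm that makes one round of at most $n^c$ non-adaptive independence queries and outputs a set $D\subseteq E$, such that for every matroid $\mathcal M$ on $E$ in which $S$ is globally optimal and $\alpha(S)/|S|<1/\log n$, with probability at least $1-2^{-\varepsilon n}$, $D$ is a set of redundant elements of $S$ and 1. $|D|\ \ge\ \dfrac{\delta}{(\log n)^k}\,\min\left(|S|,\ \dfrac{\ell\,|S|^2}{\alpha(S)^2}\right)$; 2. $|D|\ \ge\ \dfrac{\delta}{(\log n)^k}\cdot\dfrac{|S|}{\max(1,\ell)}$, and moreover $|D|\ \ge\ \dfrac{\delta}{(\log n)^k}\cdot\dfrac{|S|}{\ell}$ whenever $|\mathrm{CORE}_S|\le |S|/2$. -/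

import Mathlib

open Finset

noncomputable section

/-- Probability of the event `P` when `ω` is drawn uniformly from the finite set `Ω`. -/
def uniformProb (Ω : Type*) [Fintype Ω] (P : Ω → Prop) : ℝ :=
  (Nat.card {ω : Ω // P ω} : ℝ) / Fintype.card Ω

section Circuits

variable {E : Type*}

/-- The set of the first `j` elements in the order `π`. -/
def prefixSet {G : Finset E} (π : Fin #G ≃ {x : E // x ∈ G}) (j : ℕ) : Set E :=
  {x | ∃ i : Fin #G, (i : ℕ) < j ∧ ((π i : {x : E // x ∈ G}) : E) = x}

/-- `C` is the first circuit `C_π` of the restriction `M|_G` when the elements of `G` are added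
in the order `π`: the first `j` elements are independent, and `C` is a circuit contained in the
first `j + 1` elements.  There is at most one such `C`, and there is none iff `G` is
independent. -/
def IsFirstCircuit (M : Matroid E) {G : Finset E} (π : Fin #G ≃ {x : E // x ∈ G})
    (C : Set E) : Prop :=
  ∃ j : ℕ, M.Indep (prefixSet π j) ∧ M.IsCircuit C ∧ C ⊆ prefixSet π (j + 1)

open Classical in
/-- The hitting probability `p_{T, M|_G} = Pr_π [T ∩ C_π ≠ ∅]`, for a uniformly random
permutation `π` of `G`. -/
def hitProb (M : Matroid E) (G T : Finset E) : ℝ :=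
  uniformProb (Fin #G ≃ {x : E // x ∈ G}) fun π =>
    ∃ C, IsFirstCircuit M π C ∧ ((T : Set E) ∩ C).Nonempty

/-- The marginal circuit probability `p_{x, M|_G} = Pr_π [x ∈ C_π]`. -/
def marginalProb (M : Matroid E) (G : Finset E) (x : E) : ℝ := hitProb M G {x}

open Classical in
/-- The circuit mass `q_{T, M|_G} = Pr_π [C_π ⊆ T]`, for a uniformly random permutation `π`
of `G`. -/
def circuitMass (M : Matroid E) (G T : Finset E) : ℝ :=
  uniformProb (Fin #G ≃ {x : E // x ∈ G}) fun π =>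
    ∃ C, IsFirstCircuit M π C ∧ C ⊆ (T : Set E)

/-- The probability that a uniformly random `k`-element subset of `S` is independent. -/
def indepProb (M : Matroid E) (S : Finset E) (k : ℕ) : ℝ :=
  uniformProb {T : Finset E // T ∈ S.powersetCard k} fun T => M.Indep ((T : Finset E) : Set E)

/-- `α(S)`: the least `k` such that a uniformly random `k`-element subset of `S` is independent
with probability at most `1/2`. -/
def alphaValue (M : Matroid E) (S : Finset E) : ℕ :=
  sInf {k : ℕ | indepProb M S k ≤ 1 / 2}

open Classical in
/-- `CORE_S = {x ∈ S : p_{x, M|_S} ≥ α(S)² / |S|²}`. -/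
def coreSet (M : Matroid E) (S : Finset E) : Finset E :=
  S.filter fun x => (alphaValue M S : ℝ) ^ 2 / (#S : ℝ) ^ 2 ≤ marginalProb M S x

open Classical in
/-- `ℓ = ∑_{i ∈ S \ CORE_S} p_{i, M|_S}`. -/
def nonCoreMass (M : Matroid E) (S : Finset E) : ℝ :=
  ∑ i ∈ S \ coreSet M S, marginalProb M S i

/-- `S` is globally optimal in the matroid `M` whose ground set is the whole finite type `E`. -/
def GloballyOptimal [Fintype E] (M : Matroid E) (S : Finset E) : Prop :=
  1 - 1 / 2 ^ 20 ≤ circuitMass M Finset.univ S ∧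
  ∀ T : Finset E, T ⊆ S →
    (#T : ℝ) / (2 ^ 21 * #S * Real.logb 2 (Fintype.card E)) ≤ hitProb M S T

/-- `D` is a set of redundant elements of `S`: it is contained in `S`, and each of its elements
lies in the span of `S \ D` (hence also in the span of the ground set minus `D`), so that all of
`D` can be deleted simultaneously without changing the rank. -/
def IsRedundantIn (M : Matroid E) (S D : Finset E) : Prop :=
  D ⊆ S ∧ (D : Set E) ⊆ M.closure ((S : Set E) \ (D : Set E))

end Circuits

section Algorithms

/-- A randomized algorithm that makes a single round of queries to a set oracle on `E` and
returns a subset of `E`.  The queries depend only on the internal randomness (a seed, drawn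
uniformly from a finite set); the output depends only on the seed and on the answers to the
queries made. -/
structure OneRoundAlgorithm (E : Type*) where
  Seed : Type
  seedFintype : Fintype Seed
  seedNonempty : Nonempty Seed
  queries : Seed → Finset (Finset E)
  output : (ω : Seed) → ({Q : Finset E // Q ∈ queries ω} → Bool) → Finset E

attribute [instance] OneRoundAlgorithm.seedFintype OneRoundAlgorithm.seedNonempty

open Classical in
/-- The independence oracle of the matroid `M`. -/
def indOracle {E : Type*} (M : Matroid E) (Q : Finset E) : Bool :=
  decide (M.Indep (Q : Set E))

/-- The output on seed `ω` when the queries are answered by the independence oracle of `M`. -/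
def OneRoundAlgorithm.run {E : Type*} (A : OneRoundAlgorithm E) (M : Matroid E) (ω : A.Seed) :
    Finset E :=
  A.output ω fun Q => indOracle M Q.1

end Algorithms

end

/-! ### Uniform probability on finite types: union bound, product events, Markov inequalities. -/

section UniformProb

variable {Ω : Type*} [Fintype Ω]

/-! Write s = |S|, L = log n, α = α(S), p for a marginal circuit probability. The algorithm samples
n^6 blocks of n random orderings of S, queries all sets "initial segment plus one element" and all
these less one element, and returns a largest `Certified` set. If W is dependent and W - x
independent, then W contains exactly one circuit C, and C consists of the d whose removal makes W
independent (`Matroid.Indep.sdiff_singleton_indep_iff`). So the answers verify C ∩ D = {x}, and x is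
spanned by C - x, outside D. Soundness is thus deterministic; what remains is that large certified
sets exist except with probability 2⁻ⁿ (`CertifiesWhp`). They come from two sources.

Small intersections (`CertifiesWhp.of_hits`). Let X be at least half of S and ℓ the expected number
of elements of X in the first circuit. By global optimality each T ⊆ X with |T| ≥ s/4 is hit with
probability of order 1/L; by Markov, circuits with far more than Lℓ elements in X account for at
most half of this. A union bound over T shows that at least s/4 elements of X lie on sampled
circuits with O(Lℓ) elements in X. An independent set in the resulting sparse digraph gives about
s/(Lℓ) elements, each alone in D on its own circuit. This is applied to X = S \ CORE_S.

Spanned elements (`CertifiesWhp.of_blocks`). Among g orderings, consider the x that avoid the first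
K positions of all of them and are spanned by an independent segment shorter than K of one of them.
They are certified together, since their test sets contain no other such element. Moving x from
before position K to after it shows that x is spanned with probability at least (s - K)/K times that
of lying on a circuit closed within the first K elements (`sub_mul_earlyProb_le`). Independence of
prefixes is submultiplicative, so for K ≈ 4Lα almost every first circuit is closed that early. With
g ≈ s/(2K), x is found with probability of order min(1, p s²/(Lα)²). Up to powers of L this sums to
ℓs²/α² off the core and to s over a core containing half of S. -/

theorem uniformProb_eq_card_filter (P : Ω → Prop) [DecidablePred P] :
    uniformProb Ω P = (#(univ.filter P) : ℝ) / Fintype.card Ω := by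
  unfold uniformProb
  rw [Nat.card_eq_fintype_card, Fintype.card_subtype]

theorem uniformProb_nonneg (P : Ω → Prop) : 0 ≤ uniformProb Ω P := by
  unfold uniformProb; positivity

theorem uniformProb_mono {P Q : Ω → Prop} (h : ∀ ω, P ω → Q ω) :
    uniformProb Ω P ≤ uniformProb Ω Q := by
  classical
  rw [uniformProb_eq_card_filter, uniformProb_eq_card_filter]
  gcongr with ω
  exact h ω

theorem uniformProb_le_one (P : Ω → Prop) : uniformProb Ω P ≤ 1 := by
  classical
  rw [uniformProb_eq_card_filter]
  apply div_le_one_of_le₀ _ (by positivity)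
  exact_mod_cast Finset.card_le_univ _

theorem uniformProb_true [Nonempty Ω] {P : Ω → Prop} (h : ∀ ω, P ω) : uniformProb Ω P = 1 := by
  classical
  rw [uniformProb_eq_card_filter, Finset.filter_true_of_mem (fun ω _ => h ω), card_univ]
  exact div_self (by exact_mod_cast Fintype.card_ne_zero)

theorem uniformProb_not [Nonempty Ω] (P : Ω → Prop) :
    uniformProb Ω (fun ω => ¬ P ω) = 1 - uniformProb Ω P := by
  classical
  rw [uniformProb_eq_card_filter, uniformProb_eq_card_filter, eq_sub_iff_add_eq, ← add_div,
    div_eq_one_iff_eq (by exact_mod_cast Fintype.card_ne_zero), add_comm]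
  exact_mod_cast card_filter_add_card_filter_not (s := univ) P

/-- A sum of probabilities is the average of a counting function. -/
theorem sum_uniformProb {ι : Type*} (X : Finset ι) (Q : ι → Ω → Prop)
    [∀ ω, DecidablePred fun x => Q x ω] :
    ∑ x ∈ X, uniformProb Ω (Q x) = (∑ ω, (#(X.filter fun x => Q x ω) : ℝ)) / Fintype.card Ω := by
  classical
  simp_rw [uniformProb_eq_card_filter, ← sum_div, card_filter]
  push_cast
  rw [sum_comm]

theorem uniformProb_le_sum {ι : Type*} (X : Finset ι) (P : Ω → Prop) (Q : ι → Ω → Prop)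
    (h : ∀ ω, P ω → ∃ x ∈ X, Q x ω) : uniformProb Ω P ≤ ∑ x ∈ X, uniformProb Ω (Q x) := by
  classical
  rw [sum_uniformProb, uniformProb_eq_card_filter, card_filter]
  push_cast
  gcongr with ω
  split_ifs with hP
  · obtain ⟨x, hx, hQ⟩ := h ω hP
    exact_mod_cast card_pos.2 ⟨x, mem_filter.2 ⟨hx, hQ⟩⟩
  · positivity

theorem uniformProb_le_add (P Q R : Ω → Prop) (h : ∀ ω, P ω → Q ω ∨ R ω) :
    uniformProb Ω P ≤ uniformProb Ω Q + uniformProb Ω R := by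
  have := uniformProb_le_sum (Ω := Ω) (univ : Finset Bool) P (fun b ω => cond b (Q ω) (R ω))
    (fun ω hω => by
      rcases h ω hω with h | h
      · exact ⟨true, mem_univ _, h⟩
      · exact ⟨false, mem_univ _, h⟩)
  simpa using this

theorem uniformProb_and_not {P Q : Ω → Prop} (h : ∀ ω, Q ω → P ω) :
    uniformProb Ω (fun ω => P ω ∧ ¬ Q ω) = uniformProb Ω P - uniformProb Ω Q := by
  classical
  rw [uniformProb_eq_card_filter, uniformProb_eq_card_filter, uniformProb_eq_card_filter,
    eq_sub_iff_add_eq, ← add_div]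
  congr 1
  rw [← Nat.cast_add]
  congr 1
  rw [← card_filter_add_card_filter_not (s := univ.filter P) Q, filter_filter, filter_filter,
    add_comm]
  congr 2
  ext ω
  have := h ω
  simp only [mem_filter, mem_univ, true_and]; tauto

/-- Independence of the coordinates of a uniformly random function. -/
theorem uniformProb_pi {ι : Type*} [Fintype ι] [DecidableEq ι] (Q : ι → Ω → Prop) :
    uniformProb (ι → Ω) (fun f => ∀ i, Q i (f i)) = ∏ i, uniformProb Ω (Q i) := by
  classical
  simp_rw [uniformProb_eq_card_filter]
  rw [prod_div_distrib, prod_const, Fintype.card_fun, card_univ]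
  push_cast
  congr 1
  rw [← Nat.cast_prod, ← Fintype.card_piFinset]
  congr 2
  ext f
  simp [Fintype.mem_piFinset]

theorem uniformProb_pi_const {ι : Type*} [Fintype ι] [DecidableEq ι] (Q : Ω → Prop) :
    uniformProb (ι → Ω) (fun f => ∀ i, Q (f i)) = uniformProb Ω Q ^ Fintype.card ι := by
  rw [uniformProb_pi (fun _ => Q), prod_const, card_univ]

theorem uniformProb_pi_initial {n g : ℕ} (hg : g ≤ n) [Nonempty Ω] (Q : Ω → Prop) :
    uniformProb (Fin n → Ω) (fun f => ∀ i : Fin n, (i : ℕ) < g → Q (f i)) =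
      uniformProb Ω Q ^ g := by
  classical
  rw [uniformProb_pi (fun (i : Fin n) ω => (i : ℕ) < g → Q ω)]
  have : ∀ i : Fin n, uniformProb Ω (fun ω => (i : ℕ) < g → Q ω) =
      if (i : ℕ) < g then uniformProb Ω Q else 1 := by
    intro i
    split_ifs with h
    · simp [h]
    · exact uniformProb_true fun ω h' => absurd h' h
  simp_rw [this]
  rw [prod_ite, prod_const, prod_const_one, mul_one, Fin.card_filter_val_lt, min_eq_right hg]

/-- Markov's inequality for the number of events of a family that occur. -/
theorem uniformProb_lt_card_mul_le {ι : Type*} (X : Finset ι) (Q : ι → Ω → Prop)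
    (P : Ω → Prop) (t : ℝ)
    (h : ∀ ω, P ω → ∃ Y ⊆ X, (∀ x ∈ Y, Q x ω) ∧ t ≤ #Y) :
    uniformProb Ω P * t ≤ ∑ x ∈ X, uniformProb Ω (Q x) := by
  classical
  rw [sum_uniformProb, uniformProb_eq_card_filter, card_filter, div_mul_eq_mul_div]
  push_cast
  rw [sum_mul]
  gcongr with ω
  split_ifs with hP
  · obtain ⟨Y, hY, hQ, ht⟩ := h ω hP
    rw [one_mul]
    refine ht.trans ?_
    exact_mod_cast card_le_card fun x hx => mem_filter.2 ⟨hY hx, hQ x hx⟩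
  · rw [zero_mul]; positivity

/-- Reverse Markov inequality for the size of a random set. -/
theorem le_uniformProb_half_le_card [Nonempty Ω] {ι : Type*} (X : Finset ι) (Q : ι → Ω → Prop)
    [∀ ω, DecidablePred fun x => Q x ω]
    (μ : ℝ) (h : μ ≤ ∑ x ∈ X, uniformProb Ω (Q x)) :
    μ / 2 ≤ #X * uniformProb Ω (fun ω => μ / 2 ≤ #(X.filter fun x => Q x ω)) := by
  classical
  rw [sum_uniformProb] at h
  have hc : (0 : ℝ) < Fintype.card Ω := by exact_mod_cast Fintype.card_pos
  rw [le_div_iff₀ hc] at h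
  rw [uniformProb_eq_card_filter, mul_div_assoc', le_div_iff₀ hc, card_filter]
  push_cast
  by_cases hμ : μ ≤ 0
  · calc μ / 2 * (Fintype.card Ω : ℝ) ≤ 0 := mul_nonpos_of_nonpos_of_nonneg (by linarith) hc.le
      _ ≤ _ := by positivity
  push Not at hμ
  have key : ∑ ω, (#(X.filter fun x => Q x ω) : ℝ) ≤
      ∑ ω : Ω, (μ / 2 + #X * if μ / 2 ≤ #(X.filter fun x => Q x ω) then (1 : ℝ) else 0) := by
    gcongr with ω
    split_ifs with hω
    · have : (#(X.filter fun x => Q x ω) : ℝ) ≤ #X := by exact_mod_cast card_filter_le _ _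
      linarith
    · push Not at hω; linarith
  rw [sum_add_distrib, ← mul_sum, sum_const, card_univ, nsmul_eq_mul] at key
  linarith

end UniformProb

/-! ### Comparison of probabilities under bijections and for disjoint events. -/

section UniformProb

variable {Ω : Type*} [Fintype Ω]

theorem uniformProb_le_of_equiv (e : Ω ≃ Ω) {P Q : Ω → Prop} (h : ∀ ω, P ω → Q (e ω)) :
    uniformProb Ω P ≤ uniformProb Ω Q := by
  classical
  rw [uniformProb_eq_card_filter, uniformProb_eq_card_filter]
  have : #(univ.filter P) ≤ #(univ.filter Q) :=
    card_le_card_of_injOn e (fun ω hω => by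
      simp only [coe_filter, mem_univ, true_and, Set.mem_ofPred_eq] at hω ⊢
      exact h ω hω) e.injective.injOn
  gcongr

theorem sum_uniformProb_le {ι : Type*} (X : Finset ι) (P : Ω → Prop) (Q : ι → Ω → Prop)
    (h : ∀ ω, ∀ x ∈ X, Q x ω → P ω) (hd : ∀ ω, ∀ x ∈ X, ∀ y ∈ X, Q x ω → Q y ω → x = y) :
    ∑ x ∈ X, uniformProb Ω (Q x) ≤ uniformProb Ω P := by
  classical
  rw [sum_uniformProb, uniformProb_eq_card_filter, card_filter]
  push_cast
  gcongr with ω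
  split_ifs with hP
  · have : #(X.filter fun x => Q x ω) ≤ 1 := card_le_one.2 fun x hx y hy =>
      hd ω x (mem_filter.1 hx).1 y (mem_filter.1 hy).1 (mem_filter.1 hx).2 (mem_filter.1 hy).2
    exact_mod_cast this
  · have : X.filter (fun x => Q x ω) = ∅ := filter_eq_empty_iff.2 fun x hx hQ => hP (h ω x hx hQ)
    simp [this]

end UniformProb

/-! ### The unique circuit of an independent set plus one element. -/

section Matroid

variable {E : Type*} {M : Matroid E}

theorem Matroid.not_indep_of_isCircuit_subset {C X : Set E} (hC : M.IsCircuit C) (h : C ⊆ X) :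
    ¬ M.Indep X := fun hX => hC.not_indep (hX.subset h)

/-- If `I` is independent, then deleting `d` from a set `W ⊆ I ∪ {e}` that contains the circuit
`C` gives an independent set exactly if `d ∈ C`. -/
theorem Matroid.Indep.sdiff_singleton_indep_iff (hM : M.E = Set.univ) {I C W : Set E} {e d : E}
    (hI : M.Indep I) (hC : M.IsCircuit C) (hCW : C ⊆ W) (hW : W ⊆ insert e I) :
    M.Indep (W \ {d}) ↔ d ∈ C := by
  constructor
  · intro h
    by_contra hd
    exact not_indep_of_isCircuit_subset hC (Set.subset_sdiff_singleton hCW hd) h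
  · intro hd
    by_contra h
    have hdep : M.Dep (W \ {d}) := ⟨h, by rw [hM]; exact Set.subset_univ _⟩
    obtain ⟨C', hC', hcirc⟩ := hdep.exists_isCircuit_subset
    -- Both circuits lie in `insert e I`, so both are the fundamental circuit of `e` and coincide.
    have h1 := hC.eq_fundCircuit_of_subset hI (hCW.trans hW)
    have h2 := hcirc.eq_fundCircuit_of_subset hI ((hC'.trans Set.sdiff_subset).trans hW)
    rw [h1, ← h2] at hd
    exact (hC' hd).2 rfl

end Matroid

/-! ### Random orderings and their initial segments. -/

section Orderings

open Classical

variable {E : Type*} {S : Finset E}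

/-- The image of a set of positions under an ordering of `S`. -/
noncomputable def imageSet (σ : Fin #S ≃ {x : E // x ∈ S}) (P : Finset (Fin #S)) : Finset E :=
  P.map (σ.toEmbedding.trans (Function.Embedding.subtype _))

/-- The first `j` elements in the order `σ`. -/
noncomputable def initialSeg (σ : Fin #S ≃ {x : E // x ∈ S}) (j : ℕ) : Finset E :=
  imageSet σ (univ.filter fun i => (i : ℕ) < j)

theorem mem_imageSet {σ : Fin #S ≃ {x : E // x ∈ S}} {P : Finset (Fin #S)} {x : E} :
    x ∈ imageSet σ P ↔ ∃ i ∈ P, (σ i : E) = x := by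
  simp [imageSet]

theorem mem_initialSeg {σ : Fin #S ≃ {x : E // x ∈ S}} {j : ℕ} {x : E} :
    x ∈ initialSeg σ j ↔ ∃ i : Fin #S, (i : ℕ) < j ∧ (σ i : E) = x := by
  simp [initialSeg, mem_imageSet]

theorem coe_initialSeg (σ : Fin #S ≃ {x : E // x ∈ S}) (j : ℕ) :
    (initialSeg σ j : Set E) = prefixSet σ j := by
  ext x
  simp [mem_initialSeg, prefixSet]

theorem initialSeg_subset (σ : Fin #S ≃ {x : E // x ∈ S}) (j : ℕ) : initialSeg σ j ⊆ S := by
  intro x hx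
  obtain ⟨i, -, rfl⟩ := mem_initialSeg.1 hx
  exact (σ i).2

theorem initialSeg_mono (σ : Fin #S ≃ {x : E // x ∈ S}) {i j : ℕ} (h : i ≤ j) :
    initialSeg σ i ⊆ initialSeg σ j := by
  intro x hx
  obtain ⟨k, hk, rfl⟩ := mem_initialSeg.1 hx
  exact mem_initialSeg.2 ⟨k, hk.trans_le h, rfl⟩

theorem imageSet_mono (σ : Fin #S ≃ {x : E // x ∈ S}) {P Q : Finset (Fin #S)} (h : P ⊆ Q) :
    imageSet σ P ⊆ imageSet σ Q := map_subset_map.2 h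

theorem initialSeg_of_card_le (σ : Fin #S ≃ {x : E // x ∈ S}) {j : ℕ} (h : #S ≤ j) :
    initialSeg σ j = S := by
  refine (initialSeg_subset σ j).antisymm fun x hx => mem_initialSeg.2 ⟨σ.symm ⟨x, hx⟩, ?_, by simp⟩
  exact (Fin.is_lt _).trans_le h

theorem card_initialSeg (σ : Fin #S ≃ {x : E // x ∈ S}) {j : ℕ} (h : j ≤ #S) :
    #(initialSeg σ j) = j := by
  rw [initialSeg, imageSet, card_map, Fin.card_filter_val_lt, min_eq_right h]

/-- The argument `x` only supplies a value of `e` when `j ≥ #S` and the segment no longer grows. -/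
theorem initialSeg_succ_subset (σ : Fin #S ≃ {x : E // x ∈ S}) (j : ℕ) (x : E) :
    ∃ e, (initialSeg σ (j + 1) : Set E) ⊆ insert e (initialSeg σ j : Set E) := by
  by_cases hj : j < #S
  · refine ⟨σ ⟨j, hj⟩, fun y hy => ?_⟩
    obtain ⟨i, hi, rfl⟩ := mem_initialSeg.1 (mem_coe.1 hy)
    rcases Nat.lt_succ_iff_lt_or_eq.1 hi with h | h
    · exact Or.inr (mem_coe.2 (mem_initialSeg.2 ⟨i, h, rfl⟩))
    · left; congr 2; exact Fin.ext h
  · refine ⟨x, fun y hy => Or.inr ?_⟩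
    push Not at hj
    rw [initialSeg_of_card_le σ (by omega)] at hy ⊢
    exact hy

theorem indep_initialSeg_sdiff_iff {M : Matroid E} (hM : M.E = Set.univ)
    {σ : Fin #S ≃ {x : E // x ∈ S}} {j : ℕ} {C : Set E} (hI : M.Indep (initialSeg σ j : Set E))
    (hC : M.IsCircuit C) (h : C ⊆ (initialSeg σ (j + 1) : Set E)) (d : E) :
    M.Indep ((initialSeg σ (j + 1) : Set E) \ {d}) ↔ d ∈ C := by
  obtain ⟨e, he⟩ := initialSeg_succ_subset σ j d
  exact hI.sdiff_singleton_indep_iff hM hC h he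

/-- Moving the element at position `i` to the later position `i'` removes it from the initial
segments that end between the two positions. -/
theorem coe_initialSeg_cycleIcc_trans (σ : Fin #S ≃ {x : E // x ∈ S}) {i i' : Fin #S} {j : ℕ}
    (hij : (i : ℕ) ≤ j) (hji : j ≤ i') :
    (initialSeg ((Fin.cycleIcc i i').trans σ) j : Set E) =
      (initialSeg σ (j + 1) : Set E) \ {(σ i : E)} := by
  have : NeZero #S := ⟨fun h => by have := i.2; omega⟩
  -- Addition in `Fin` wraps around; below `i'` it cannot.
  have hsucc : ∀ k : Fin #S, k < i' → ((k + 1 : Fin #S) : ℕ) = k + 1 := fun k hk =>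
    Fin.val_add_one_of_lt' (by have := i'.2; have : (k : ℕ) < i' := hk; omega)
  ext x
  simp only [mem_coe, mem_initialSeg, Set.mem_sdiff, Set.mem_singleton_iff, Equiv.trans_apply]
  constructor
  · rintro ⟨k, hk, rfl⟩
    have hki' : k < i' := Fin.lt_def.2 (hk.trans_le hji)
    rcases lt_or_ge k i with h | h
    · rw [Fin.cycleIcc_of_lt h]
      refine ⟨⟨k, by omega, rfl⟩, fun h' => ?_⟩
      exact h.ne (σ.injective (Subtype.ext h'))
    · rw [Fin.cycleIcc_of_ge_of_lt h hki']
      refine ⟨⟨k + 1, by rw [hsucc k hki']; omega, rfl⟩, fun h' => ?_⟩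
      have := congrArg Fin.val (σ.injective (Subtype.ext h'))
      rw [hsucc k hki'] at this
      have : (i : ℕ) ≤ k := h
      omega
  · rintro ⟨⟨k, hk, rfl⟩, hne⟩
    have hki : k ≠ i := fun h => hne (by rw [h])
    rcases lt_or_gt_of_ne hki with h | h
    · refine ⟨k, ?_, by rw [Fin.cycleIcc_of_lt h]⟩
      have : (k : ℕ) < i := h
      omega
    · have hik : (i : ℕ) < k := h
      let l : Fin #S := ⟨k - 1, by omega⟩
      have hl : l < i' := Fin.lt_def.2 (by simp only [l]; omega)
      refine ⟨l, by simp only [l]; omega, ?_⟩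
      rw [Fin.cycleIcc_of_ge_of_lt (Fin.le_def.2 (by simp only [l]; omega)) hl]
      congr 2
      apply Fin.ext
      rw [hsucc l hl]
      simp only [l]; omega

/-! ### Independence of random prefixes and `alphaValue`. -/

theorem exists_perm_forall_val_lt {n k : ℕ} (P : Finset (Fin n)) (hP : #P ≤ k) :
    ∃ κ : Equiv.Perm (Fin n), ∀ i ∈ P, (κ i : ℕ) < k := by
  have h : #P ≤ #(univ.filter fun i : Fin n => (i : ℕ) < k) := by
    rw [Fin.card_filter_val_lt]
    exact le_min ((card_le_univ P).trans_eq (Fintype.card_fin n)) hP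
  obtain ⟨Q, hQ, hc⟩ := exists_subset_card_eq h
  let e : {x // x ∈ P} ≃ {x // x ∈ Q} := equivOfCardEq hc.symm
  refine ⟨e.extendSubtype, fun i hi => ?_⟩
  exact (mem_filter.1 (hQ (e.extendSubtype_mem i hi))).2

/-- The probability that the first `j` elements of a random ordering are independent. -/
noncomputable def prefixIndepProb (M : Matroid E) (S : Finset E) (j : ℕ) : ℝ :=
  uniformProb (Fin #S ≃ {x : E // x ∈ S}) fun σ => M.Indep (initialSeg σ j : Set E)

/-- Permuting positions preserves the uniform distribution, so `P` may be moved into the first `k`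
positions, where independence is inherited. -/
theorem prefixIndepProb_le_of_card_le (M : Matroid E) (P : Finset (Fin #S)) {k : ℕ} (h : #P ≤ k) :
    prefixIndepProb M S k ≤
      uniformProb (Fin #S ≃ {x : E // x ∈ S}) fun σ => M.Indep (imageSet σ P : Set E) := by
  obtain ⟨κ, hκ⟩ := exists_perm_forall_val_lt P h
  let e : (Fin #S ≃ {x : E // x ∈ S}) ≃ (Fin #S ≃ {x : E // x ∈ S}) :=
    ⟨fun σ => κ.trans σ, fun σ => κ.symm.trans σ, fun σ => by ext; simp, fun σ => by ext; simp⟩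
  refine uniformProb_le_of_equiv e fun σ hσ => hσ.subset fun x hx => ?_
  obtain ⟨i, hi, rfl⟩ := mem_imageSet.1 (mem_coe.1 hx)
  exact mem_coe.2 (mem_initialSeg.2 ⟨κ i, hκ i hi, rfl⟩)

theorem initialSeg_perm_trans (κ : Equiv.Perm (Fin #S)) (σ : Fin #S ≃ {x : E // x ∈ S}) (j : ℕ) :
    initialSeg (κ.trans σ) j = imageSet σ ((univ.filter fun i : Fin #S => (i : ℕ) < j).map κ.toEmbedding) := by
  ext x
  simp only [mem_initialSeg, mem_imageSet, Equiv.trans_apply, mem_map_equiv, mem_filter, mem_univ,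
    true_and]
  exact ⟨fun ⟨i, hi, hx⟩ => ⟨κ i, by simpa using hi, hx⟩,
    fun ⟨i, hi, hx⟩ => ⟨κ.symm i, hi, by simpa using hx⟩⟩

theorem nonempty_ordering (S : Finset E) : Nonempty (Fin #S ≃ {x : E // x ∈ S}) :=
  ⟨S.equivFin.symm⟩

theorem card_filter_perm_trans (A : (Fin #S ≃ {x : E // x ∈ S}) → Prop) [DecidablePred A]
    (σ : Fin #S ≃ {x : E // x ∈ S}) :
    #(univ.filter fun κ : Equiv.Perm (Fin #S) => A (κ.trans σ)) = #(univ.filter A) := by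
  refine card_bij' (fun κ _ => κ.trans σ) (fun τ _ => τ.trans σ.symm) ?_ ?_ ?_ ?_
  · intro κ hκ; simpa using hκ
  · intro τ hτ
    simp only [mem_filter, mem_univ, true_and] at hτ ⊢
    convert hτ
    ext; simp
  · intro κ _; ext; simp
  · intro τ _; ext; simp

/-- Independence of longer and longer prefixes is submultiplicative. -/
theorem prefixIndepProb_add_le (M : Matroid E) (S : Finset E) (a b : ℕ) :
    prefixIndepProb M S (a + b) ≤ prefixIndepProb M S a * prefixIndepProb M S b := by
  have := nonempty_ordering S
  have hN : (0 : ℝ) < Fintype.card (Fin #S ≃ {x : E // x ∈ S}) := by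
    exact_mod_cast Fintype.card_pos
  have hκ : (0 : ℝ) < Fintype.card (Equiv.Perm (Fin #S)) := by exact_mod_cast Fintype.card_pos
  have hcard : (Fintype.card (Equiv.Perm (Fin #S)) : ℝ) =
      Fintype.card (Fin #S ≃ {x : E // x ∈ S}) := by
    rw [Fintype.card_equiv this.some, Fintype.card_perm]
  -- For fixed `κ` the two segments occupy at most `a + b` positions. Averaged over `κ`, the second
  -- is a fresh uniform prefix, which decouples the two events.
  have key : ∀ κ : Equiv.Perm (Fin #S), prefixIndepProb M S (a + b) ≤
      uniformProb (Fin #S ≃ {x : E // x ∈ S}) fun σ => M.Indep (initialSeg σ a : Set E) ∧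
        M.Indep (initialSeg (κ.trans σ) b : Set E) := by
    intro κ
    refine (prefixIndepProb_le_of_card_le M ((univ.filter fun i => (i : ℕ) < a) ∪
      (univ.filter fun i : Fin #S => (i : ℕ) < b).map κ.toEmbedding) ?_).trans ?_
    · refine (card_union_le _ _).trans ?_
      rw [card_map, Fin.card_filter_val_lt, Fin.card_filter_val_lt]
      omega
    · refine uniformProb_mono fun σ hσ => ⟨hσ.subset ?_, hσ.subset ?_⟩
      · exact coe_subset.2 (imageSet_mono σ subset_union_left)
      · rw [initialSeg_perm_trans]
        exact coe_subset.2 (imageSet_mono σ subset_union_right)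
  have hsum := sum_le_sum fun κ (_ : κ ∈ (univ : Finset (Equiv.Perm (Fin #S)))) => key κ
  rw [sum_const, card_univ, nsmul_eq_mul, sum_uniformProb] at hsum
  have hcount : ∀ σ : Fin #S ≃ {x : E // x ∈ S},
      (#(univ.filter fun κ : Equiv.Perm (Fin #S) => M.Indep (initialSeg σ a : Set E) ∧
        M.Indep (initialSeg (κ.trans σ) b : Set E)) : ℝ) =
      (if M.Indep (initialSeg σ a : Set E) then (1 : ℝ) else 0) *
        #(univ.filter fun τ : Fin #S ≃ {x : E // x ∈ S} => M.Indep (initialSeg τ b : Set E)) := by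
    intro σ
    split_ifs with h
    · simp only [h, true_and, one_mul]
      exact congrArg Nat.cast
        (card_filter_perm_trans (fun τ => M.Indep (initialSeg τ b : Set E)) σ)
    · simp [h]
  simp_rw [hcount, ← sum_mul] at hsum
  rw [hcard] at hsum
  rw [prefixIndepProb, prefixIndepProb, prefixIndepProb, uniformProb_eq_card_filter,
    uniformProb_eq_card_filter _, uniformProb_eq_card_filter _] at *
  rw [card_filter (fun σ : Fin #S ≃ {x : E // x ∈ S} => M.Indep (initialSeg σ a : Set E))]
  push_cast
  rw [div_mul_div_comm, le_div_iff₀ (by positivity)]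
  rw [le_div_iff₀ hN] at hsum
  calc _ = _ := by ring
    _ ≤ _ := hsum

theorem prefixIndepProb_mul_le (M : Matroid E) (S : Finset E) (a m : ℕ) :
    prefixIndepProb M S (m * a) ≤ prefixIndepProb M S a ^ m := by
  induction m with
  | zero => rw [pow_zero]; exact uniformProb_le_one _
  | succ m ih =>
    rw [Nat.succ_mul, pow_succ]
    exact (prefixIndepProb_add_le M S _ _).trans
      (mul_le_mul_of_nonneg_right ih (uniformProb_nonneg _))

/-- The first `k` elements of a random ordering form a uniformly random `k`-element subset. -/
theorem prefixIndepProb_eq_indepProb (M : Matroid E) {k : ℕ} (hk : k ≤ #S) :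
    prefixIndepProb M S k = indepProb M S k := by
  have := nonempty_ordering S
  obtain ⟨T₀, hT₀, hc₀⟩ := exists_subset_card_eq hk
  set c := #(univ.filter fun σ : Fin #S ≃ {x : E // x ∈ S} => initialSeg σ k = T₀) with hc
  -- A permutation of `S` that carries `T` to `T'` injects the orderings beginning with `T` into
  -- those beginning with `T'`; so all fibres have the same size.
  have hle : ∀ T T' : Finset E, T ∈ S.powersetCard k → T' ∈ S.powersetCard k →
      #(univ.filter fun σ : Fin #S ≃ {x : E // x ∈ S} => initialSeg σ k = T) ≤
      #(univ.filter fun σ : Fin #S ≃ {x : E // x ∈ S} => initialSeg σ k = T') := by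
    intro T T' hT hT'
    rw [mem_powersetCard] at hT hT'
    have hcard : Fintype.card {x : {x : E // x ∈ S} // (x : E) ∈ T} =
        Fintype.card {x : {x : E // x ∈ S} // (x : E) ∈ T'} := by
      have aux : ∀ U : Finset E, U ⊆ S →
          Fintype.card {x : {x : E // x ∈ S} // (x : E) ∈ U} = #U := by
        intro U hU
        rw [← Fintype.card_coe U]
        exact Fintype.card_congr ⟨fun x => ⟨x.1.1, x.2⟩, fun x => ⟨⟨x.1, hU x.2⟩, x.2⟩,
          fun _ => rfl, fun _ => rfl⟩
      rw [aux T hT.1, aux T' hT'.1, hT.2, hT'.2]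
    let e := Fintype.equivOfCardEq hcard
    let ψ := e.extendSubtype
    refine card_le_card_of_injOn (fun σ => σ.trans ψ) (fun σ hσ => ?_) (fun σ _ τ _ h => ?_)
    · simp only [coe_filter, mem_univ, true_and, Set.mem_ofPred_eq] at hσ ⊢
      refine eq_of_subset_of_card_le (fun x hx => ?_) ?_
      · obtain ⟨i, hi, rfl⟩ := mem_initialSeg.1 hx
        refine e.extendSubtype_mem (σ i) ?_
        rw [← hσ]
        exact mem_initialSeg.2 ⟨i, hi, rfl⟩
      · rw [card_initialSeg _ hk, hT'.2]
    · ext i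
      have := congrArg (fun τ : Fin #S ≃ {x : E // x ∈ S} => τ i) h
      simpa using this
  have hconst : ∀ T ∈ S.powersetCard k,
      #(univ.filter fun σ : Fin #S ≃ {x : E // x ∈ S} => initialSeg σ k = T) = c := fun T hT =>
    have h0 := mem_powersetCard.2 ⟨hT₀, hc₀⟩
    (hle T T₀ hT h0).antisymm (hle T₀ T h0 hT)
  have hmem : ∀ σ : Fin #S ≃ {x : E // x ∈ S}, initialSeg σ k ∈ S.powersetCard k := fun σ =>
    mem_powersetCard.2 ⟨initialSeg_subset σ k, card_initialSeg σ hk⟩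
  have hall : Fintype.card (Fin #S ≃ {x : E // x ∈ S}) = #(S.powersetCard k) * c := by
    rw [← card_univ, card_eq_sum_card_fiberwise (t := S.powersetCard k) fun σ _ => hmem σ,
      sum_congr rfl hconst, sum_const, smul_eq_mul]
  have hgood : #(univ.filter fun σ : Fin #S ≃ {x : E // x ∈ S} =>
      M.Indep (initialSeg σ k : Set E)) =
      #((S.powersetCard k).filter fun T : Finset E => M.Indep (T : Set E)) * c := by
    rw [card_eq_sum_card_fiberwise (f := fun σ => initialSeg σ k)
      (t := (S.powersetCard k).filter fun T : Finset E => M.Indep (T : Set E))]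
    · refine sum_const_nat fun T hT => ?_
      rw [mem_filter] at hT
      rw [← hconst T hT.1, filter_filter]
      congr 1
      ext σ
      simp only [mem_filter, mem_univ, true_and, and_iff_right_iff_imp]
      rintro rfl
      exact hT.2
    · intro σ hσ
      simp only [coe_filter, mem_univ, true_and, Set.mem_ofPred_eq] at hσ ⊢
      exact ⟨hmem σ, hσ⟩
  have hcpos : (0 : ℝ) < c := by
    have : 0 < #(S.powersetCard k) * c := hall ▸ Fintype.card_pos
    exact_mod_cast Nat.pos_of_mul_pos_left this
  rw [prefixIndepProb, indepProb, uniformProb_eq_card_filter, uniformProb_eq_card_filter, hgood,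
    hall, Fintype.card_coe]
  push_cast
  rw [mul_div_mul_right _ _ hcpos.ne']
  congr 2
  refine card_bij' (fun T hT => ⟨T, (mem_filter.1 hT).1⟩) (fun T _ => T.1) ?_ ?_ ?_ ?_
  · intro T hT; exact mem_filter.2 ⟨mem_univ _, (mem_filter.1 hT).2⟩
  · intro T hT; exact mem_filter.2 ⟨T.2, (mem_filter.1 hT).2⟩
  · intro T _; rfl
  · intro T _; rfl

theorem indepProb_alphaValue_le (M : Matroid E) (S : Finset E) :
    indepProb M S (alphaValue M S) ≤ 1 / 2 := by
  have hne : {k : ℕ | indepProb M S k ≤ 1 / 2}.Nonempty := by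
    -- No subset has this size, so the quotient is `0 / 0 = 0` and the infimum is attained.
    refine ⟨#S + 1, ?_⟩
    simp only [Set.mem_ofPred_eq, indepProb, uniformProb]
    rw [Fintype.card_coe, powersetCard_eq_empty.2 (Nat.lt_succ_self _)]
    simp
  exact Nat.sInf_mem hne

theorem alphaValue_pos (M : Matroid E) (S : Finset E) : 0 < alphaValue M S := by
  rw [Nat.pos_iff_ne_zero]
  intro h
  have h1 := indepProb_alphaValue_le M S
  have := nonempty_ordering S
  rw [h, ← prefixIndepProb_eq_indepProb M (Nat.zero_le _), prefixIndepProb, uniformProb_true] at h1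
  · norm_num at h1
  · intro σ
    simp [initialSeg, imageSet]

theorem prefixIndepProb_mul_alphaValue_le (M : Matroid E) (S : Finset E)
    (h : alphaValue M S ≤ #S) (m : ℕ) :
    prefixIndepProb M S (m * alphaValue M S) ≤ (1 / 2) ^ m := by
  refine (prefixIndepProb_mul_le M S _ m).trans ?_
  gcongr
  · exact uniformProb_nonneg _
  · rw [prefixIndepProb_eq_indepProb M h]
    exact indepProb_alphaValue_le M S

/-! ### From early circuits to spanned elements. -/

/-- The probability that the first circuit contains `x` and appears among the first `K`
elements. -/
noncomputable def earlyProb (M : Matroid E) (S : Finset E) (K : ℕ) (x : E) : ℝ :=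
  uniformProb (Fin #S ≃ {x : E // x ∈ S}) fun σ => ∃ j < K, ∃ C : Set E,
    M.Indep (initialSeg σ j : Set E) ∧ M.IsCircuit C ∧ C ⊆ (initialSeg σ (j + 1) : Set E) ∧ x ∈ C

/-- `x` is spanned by an independent initial segment of `σ` that ends before position `K`, while
`x` itself is not among the first `K` elements. -/
def SpannedEarly (M : Matroid E) (K : ℕ) (x : E) (σ : Fin #S ≃ {x : E // x ∈ S}) : Prop :=
  x ∉ initialSeg σ K ∧ ∃ j < K, M.Indep (initialSeg σ j : Set E) ∧
    ¬ M.Indep (insert x (initialSeg σ j : Set E))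

/-- Either the first circuit is closed within the first `K` elements, or these are independent. -/
theorem marginalProb_le (M : Matroid E) (S : Finset E) (K : ℕ) (x : E) :
    marginalProb M S x ≤ earlyProb M S K x + prefixIndepProb M S K := by
  refine uniformProb_le_add _ _ _ fun σ => ?_
  rintro ⟨C, ⟨j, hj, hC, hCs⟩, y, hy, hyC⟩
  rw [coe_singleton, Set.mem_singleton_iff] at hy
  subst hy
  rw [← coe_initialSeg] at hj hCs
  rcases lt_or_ge j K with h | h
  · exact Or.inl ⟨j, h, C, hj, hC, hCs, hyC⟩
  · exact Or.inr (hj.subset (coe_subset.2 (initialSeg_mono σ h)))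

/-- Move `x` from a position `i < K` to a position `i' ≥ K`. If `x` was on the first circuit, the
new segment of length `j` is the old one of length `j + 1` less `x`: it is independent and spans
`x`. Summing over all pairs `(i, i')` gives the factors `K` and `#S - K`. -/
theorem sub_mul_earlyProb_le {M : Matroid E} (hM : M.E = Set.univ) {K : ℕ} (hK : K ≤ #S) (x : E) :
    ((#S : ℝ) - K) * earlyProb M S K x ≤
      K * uniformProb (Fin #S ≃ {x : E // x ∈ S}) (SpannedEarly M K x) := by
  set A : Fin #S → (Fin #S ≃ {x : E // x ∈ S}) → Prop := fun i σ => (σ i : E) = x ∧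
    ∃ j < K, ∃ C : Set E, M.Indep (initialSeg σ j : Set E) ∧ M.IsCircuit C ∧
      C ⊆ (initialSeg σ (j + 1) : Set E) ∧ x ∈ C with hA
  set B : Fin #S → (Fin #S ≃ {x : E // x ∈ S}) → Prop := fun i σ => (σ i : E) = x ∧
    ∃ j < K, M.Indep (initialSeg σ j : Set E) ∧
      ¬ M.Indep (insert x (initialSeg σ j : Set E)) with hB
  set I : Finset (Fin #S) := univ.filter fun i => (i : ℕ) < K with hI
  set J : Finset (Fin #S) := univ.filter fun i => ¬ (i : ℕ) < K with hJ
  have hIc : #I = K := by rw [hI, Fin.card_filter_val_lt, min_eq_right hK]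
  have hJc : (#J : ℝ) = #S - K := by
    have := card_filter_add_card_filter_not (s := (univ : Finset (Fin #S))) fun i => (i : ℕ) < K
    rw [card_univ, Fintype.card_fin, ← hI, ← hJ, hIc] at this
    have : (K : ℝ) + #J = #S := by exact_mod_cast this
    linarith
  have h1 : earlyProb M S K x ≤ ∑ i ∈ I, uniformProb _ (A i) := by
    refine uniformProb_le_sum I _ A fun σ => ?_
    rintro ⟨j, hj, C, h1, h2, h3, h4⟩
    obtain ⟨i, hi, hix⟩ := mem_initialSeg.1 (mem_coe.1 (h3 h4))
    exact ⟨i, mem_filter.2 ⟨mem_univ _, by omega⟩, hix, j, hj, C, h1, h2, h3, h4⟩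
  have h2 : ∑ i ∈ J, uniformProb _ (B i) ≤
      uniformProb (Fin #S ≃ {x : E // x ∈ S}) (SpannedEarly M K x) := by
    refine sum_uniformProb_le J _ B (fun σ i hi h => ⟨fun hx => ?_, h.2⟩) fun σ i _ i' _ h h' => ?_
    · obtain ⟨i', hi', hx'⟩ := mem_initialSeg.1 hx
      have := σ.injective (Subtype.ext (hx'.trans h.1.symm))
      subst this
      exact (mem_filter.1 hi).2 hi'
    · exact σ.injective (Subtype.ext (h.1.trans h'.1.symm))
  have h3 : ∀ i ∈ I, ∀ i' ∈ J, uniformProb _ (A i) ≤ uniformProb _ (B i') := by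
    intro i hi i' hi'
    have hi := (mem_filter.1 hi).2
    have hi' := (mem_filter.1 hi').2
    let κ := Fin.cycleIcc i i'
    let e : (Fin #S ≃ {x : E // x ∈ S}) ≃ (Fin #S ≃ {x : E // x ∈ S}) :=
      ⟨fun σ => κ.trans σ, fun σ => κ.symm.trans σ, fun σ => by ext; simp, fun σ => by ext; simp⟩
    have : NeZero #S := ⟨fun h => by have := i.2; omega⟩
    refine uniformProb_le_of_equiv e ?_
    rintro σ ⟨hx, j, hj, C, h1, h2, h3, h4⟩
    have hij : (i : ℕ) ≤ j := by
      obtain ⟨k, hk, hkx⟩ := mem_initialSeg.1 (mem_coe.1 (h3 h4))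
      have := σ.injective (Subtype.ext (hkx.trans hx.symm))
      subst this; omega
    have hseg := coe_initialSeg_cycleIcc_trans σ hij (i' := i') (by omega)
    refine ⟨?_, j, hj, ?_, ?_⟩
    · change (σ (Fin.cycleIcc i i' i') : E) = x
      rw [Fin.cycleIcc_of_last (Fin.le_def.2 (by omega)), hx]
    · change M.Indep (initialSeg (κ.trans σ) j : Set E)
      rw [hseg, hx]
      exact (indep_initialSeg_sdiff_iff hM h1 h2 h3 x).2 h4
    · change ¬ M.Indep (insert x (initialSeg (κ.trans σ) j : Set E))
      rw [hseg, hx]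
      refine Matroid.not_indep_of_isCircuit_subset h2 fun y hy => ?_
      by_cases hyx : y = x
      · exact Or.inl hyx
      · exact Or.inr ⟨h3 hy, hyx⟩
  calc ((#S : ℝ) - K) * earlyProb M S K x
      ≤ #J * ∑ i ∈ I, uniformProb _ (A i) := by rw [hJc]; gcongr; rw [← hJc]; positivity
    _ = ∑ i ∈ I, ∑ _i' ∈ J, uniformProb _ (A i) := by
        rw [mul_sum]; simp [sum_const]
    _ ≤ ∑ _i ∈ I, ∑ i' ∈ J, uniformProb _ (B i') :=
        sum_le_sum fun i hi => sum_le_sum fun i' hi' => h3 i hi i' hi'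
    _ = K * ∑ i' ∈ J, uniformProb _ (B i') := by rw [sum_const, hIc, nsmul_eq_mul]
    _ ≤ _ := by gcongr

theorem exists_isFirstCircuit {M : Matroid E} (hM : M.E = Set.univ) (hS : ¬ M.Indep (S : Set E))
    (σ : Fin #S ≃ {x : E // x ∈ S}) : ∃ C, IsFirstCircuit M σ C := by
  have hex : ∃ j, ¬ M.Indep (initialSeg σ j : Set E) :=
    ⟨#S, by rwa [initialSeg_of_card_le σ le_rfl]⟩
  have h0 : Nat.find hex ≠ 0 := by
    intro h
    have := Nat.find_spec hex
    rw [h] at this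
    exact this (by simp [initialSeg, imageSet])
  obtain ⟨j, hj⟩ := Nat.exists_eq_succ_of_ne_zero h0
  have hdep := Nat.find_spec hex
  rw [hj] at hdep
  have hind := Nat.find_min hex (m := j) (by omega)
  rw [not_not] at hind
  have hdep' : M.Dep (initialSeg σ (j + 1) : Set E) :=
    ⟨hdep, by rw [hM]; exact Set.subset_univ _⟩
  obtain ⟨C, hCs, hC⟩ := hdep'.exists_isCircuit_subset
  exact ⟨C, j, by rwa [← coe_initialSeg], hC, by rwa [← coe_initialSeg]⟩

/-- Swapping positions shows that `x` is equally likely at each of them; the inequality form also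
covers `x ∉ S`. -/
theorem uniformProb_mem_initialSeg_le {K : ℕ} (hK : K ≤ #S) (x : E) :
    #S * uniformProb (Fin #S ≃ {x : E // x ∈ S}) (fun σ => x ∈ initialSeg σ K) ≤ K := by
  rcases Nat.eq_zero_or_pos #S with h0 | hpos
  · have : (#S : ℝ) = 0 := by exact_mod_cast h0
    rw [this, zero_mul]; positivity
  set Q : Fin #S → (Fin #S ≃ {x : E // x ∈ S}) → Prop := fun i σ => (σ i : E) = x with hQ
  let z : Fin #S := ⟨0, hpos⟩
  have hle : ∀ i i', uniformProb _ (Q i) ≤ uniformProb _ (Q i') := by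
    intro i i'
    let κ := Equiv.swap i i'
    let e : (Fin #S ≃ {x : E // x ∈ S}) ≃ (Fin #S ≃ {x : E // x ∈ S}) :=
      ⟨fun σ => κ.trans σ, fun σ => κ.symm.trans σ, fun σ => by ext; simp, fun σ => by ext; simp⟩
    refine uniformProb_le_of_equiv e fun σ h => ?_
    change (σ (Equiv.swap i i' i') : E) = x
    rw [Equiv.swap_apply_right]; exact h
  have hconst : ∀ i, uniformProb _ (Q i) = uniformProb _ (Q z) := fun i =>
    (hle i z).antisymm (hle z i)
  have hone : #S * uniformProb _ (Q z) ≤ 1 := by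
    have := sum_uniformProb_le (univ : Finset (Fin #S)) (fun _ => True) Q
      (fun _ _ _ _ => trivial) (fun σ i _ j _ h h' => σ.injective (Subtype.ext (h.trans h'.symm)))
    simp_rw [hconst] at this
    rw [sum_const, card_univ, Fintype.card_fin, nsmul_eq_mul] at this
    exact this.trans (uniformProb_le_one _)
  have hsum : uniformProb (Fin #S ≃ {x : E // x ∈ S}) (fun σ => x ∈ initialSeg σ K) ≤
      K * uniformProb _ (Q z) := by
    have := uniformProb_le_sum (univ.filter fun i : Fin #S => (i : ℕ) < K)
      (fun σ : Fin #S ≃ {x : E // x ∈ S} => x ∈ initialSeg σ K) Q (fun σ h => by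
        obtain ⟨i, hi, hx⟩ := mem_initialSeg.1 h
        exact ⟨i, mem_filter.2 ⟨mem_univ _, hi⟩, hx⟩)
    simp_rw [hconst] at this
    rwa [sum_const, Fin.card_filter_val_lt, min_eq_right hK, nsmul_eq_mul] at this
  calc _ ≤ #S * (K * uniformProb _ (Q z)) := by gcongr
    _ = K * (#S * uniformProb _ (Q z)) := by ring
    _ ≤ K * 1 := by gcongr
    _ = K := mul_one _

theorem marginalProb_nonneg (M : Matroid E) (S : Finset E) (x : E) : 0 ≤ marginalProb M S x :=
  uniformProb_nonneg _

theorem earlyProb_le_marginalProb (M : Matroid E) (S : Finset E) (K : ℕ) (x : E) :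
    earlyProb M S K x ≤ marginalProb M S x := by
  refine uniformProb_mono ?_
  rintro σ ⟨j, -, C, hI, hC, hCs, hx⟩
  rw [coe_initialSeg] at hI hCs
  exact ⟨C, ⟨j, hI, hC, hCs⟩, x, by simp, hx⟩

theorem hitProb_le_sum_marginalProb (M : Matroid E) (S X : Finset E) :
    hitProb M S X ≤ ∑ x ∈ X, marginalProb M S x := by
  refine uniformProb_le_sum X _ _ ?_
  rintro σ ⟨C, hC, x, hxX, hxC⟩
  exact ⟨x, hxX, C, hC, x, by simp, hxC⟩

end Orderings

/-! ### Independent sets in sparse digraphs. -/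

section IndependentSet

/-- A digraph on `V` with out-degrees at most `d` has an independent set of size at least
`#V / (2d + 1)`. -/
theorem exists_independent_of_outdegree_le {E : Type*} [DecidableEq E] (f : E → Finset E) (d : ℕ)
    (V : Finset E) (hf : ∀ x ∈ V, #(f x) ≤ d) :
    ∃ D ⊆ V, #V ≤ (2 * d + 1) * #D ∧ ∀ x ∈ D, ∀ y ∈ D, y ≠ x → y ∉ f x := by
  induction V using Finset.strongInduction with
  | H V ih =>
    rcases V.eq_empty_or_nonempty with rfl | hV
    · exact ⟨∅, subset_rfl, by simp, by simp⟩
    -- In-degrees within `V` average at most `d`. Keep a vertex of small in-degree, discard its at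
    -- most `2d` neighbours, and recurse.
    obtain ⟨v, hv, hin⟩ : ∃ v ∈ V, #(V.filter fun x => v ∈ f x) ≤ d := by
      by_contra! h
      have h1 : ∑ v ∈ V, d < ∑ v ∈ V, #(V.filter fun x => v ∈ f x) :=
        sum_lt_sum_of_nonempty hV h
      have h2 : ∑ v ∈ V, #(V.filter fun x => v ∈ f x) ≤ ∑ x ∈ V, d := by
        simp_rw [card_filter]
        rw [sum_comm]
        refine sum_le_sum fun x hx => ?_
        rw [← card_filter]
        exact (card_le_card fun y hy => (mem_filter.1 hy).2).trans (hf x hx)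
      exact absurd (h1.trans_le h2) (lt_irrefl _)
    set R := insert v (f v ∪ V.filter fun x => v ∈ f x) with hR
    have hRc : #R ≤ 2 * d + 1 := by
      refine (card_insert_le _ _).trans ?_
      have := card_union_le (f v) (V.filter fun x => v ∈ f x)
      have := hf v hv
      omega
    have hlt : V \ R ⊂ V :=
      ⟨sdiff_subset, fun h => (mem_sdiff.1 (h hv)).2 (mem_insert_self _ _)⟩
    obtain ⟨D, hDV, hDc, hD⟩ := ih (V \ R) hlt fun x hx => hf x (mem_sdiff.1 hx).1
    have hvD : v ∉ D := fun h => (mem_sdiff.1 (hDV h)).2 (mem_insert_self _ _)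
    refine ⟨insert v D, insert_subset hv (hDV.trans sdiff_subset), ?_, ?_⟩
    · rw [card_insert_of_notMem hvD, mul_add, mul_one]
      have := card_le_card_sdiff_add_card (s := V) (t := R)
      omega
    · intro x hx y hy hyx
      rw [mem_insert] at hx hy
      rcases hx with rfl | hx <;> rcases hy with rfl | hy
      · exact absurd rfl hyx
      · intro h
        exact (mem_sdiff.1 (hDV hy)).2 (mem_insert_of_mem (mem_union_left _ h))
      · intro h
        exact (mem_sdiff.1 (hDV hx)).2 (mem_insert_of_mem (mem_union_right _
          (mem_filter.2 ⟨(mem_sdiff.1 (hDV hx)).1, h⟩)))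
      · exact hD x hx y hy hyx

end IndependentSet

/-! ### Certificates of redundancy. -/

section Certificates

open Classical

variable {E : Type*}

/-- `D` is certified to be redundant in `S` by the answers `ans` to independence queries: every
`x ∈ D` lies in a test set `W` that becomes independent when `x` is removed, but not when any
other element of `D` is removed. -/
def Certified (ans : Finset E → Prop) (𝒲 : Finset (Finset E)) (S D : Finset E) : Prop :=
  D ⊆ S ∧ ∀ x ∈ D, ∃ W ∈ 𝒲, W ⊆ S ∧ x ∈ W ∧ ¬ ans W ∧ ans (W.erase x) ∧
    ∀ d ∈ D, d ∈ W → d ≠ x → ¬ ans (W.erase d)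

theorem Certified.congr {ans ans' : Finset E → Prop} {𝒲 : Finset (Finset E)} {S D : Finset E}
    (h : Certified ans 𝒲 S D) (hW : ∀ W ∈ 𝒲, ans W ↔ ans' W)
    (hWx : ∀ W ∈ 𝒲, ∀ x, ans (W.erase x) ↔ ans' (W.erase x)) : Certified ans' 𝒲 S D := by
  refine ⟨h.1, fun x hx => ?_⟩
  obtain ⟨W, h0, h1, h2, h3, h4, h5⟩ := h.2 x hx
  exact ⟨W, h0, h1, h2, fun h' => h3 ((hW W h0).2 h'), (hWx W h0 x).1 h4,
    fun d hd hdW hne h' => h5 d hd hdW hne ((hWx W h0 d).2 h')⟩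

/-- The only circuit `C` in `W` contains `x` and no other element of `D`, so `C \ {x}` lies in `S \
D` and spans `x`. -/
theorem Certified.isRedundantIn {M : Matroid E} (hM : M.E = Set.univ) {𝒲 : Finset (Finset E)}
    {S D : Finset E} (h : Certified (fun Q => M.Indep (Q : Set E)) 𝒲 S D) :
    IsRedundantIn M S D := by
  refine ⟨h.1, fun x hx => ?_⟩
  obtain ⟨W, -, hWS, hxW, hdep, hind, hd⟩ := h.2 x hx
  have hdep' : M.Dep (W : Set E) := ⟨hdep, by rw [hM]; exact Set.subset_univ _⟩
  obtain ⟨C, hCW, hC⟩ := hdep'.exists_isCircuit_subset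
  have hWe : (W : Set E) ⊆ insert x ((W.erase x : Finset E) : Set E) := by
    intro y hy
    by_cases hyx : y = x
    · exact Or.inl hyx
    · exact Or.inr (mem_coe.2 (mem_erase.2 ⟨hyx, hy⟩))
  have key := fun d => hind.sdiff_singleton_indep_iff (d := d) hM hC hCW hWe
  have hxC : x ∈ C := (key x).1 (by rw [← coe_erase]; exact hind)
  refine M.closure_subset_closure ?_ (hC.mem_closure_sdiff_singleton_of_mem hxC)
  rintro y ⟨hyC, hyx⟩
  refine ⟨hWS (hCW hyC), fun hyD => ?_⟩
  refine hd y hyD (hCW hyC) hyx ?_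
  have := (key y).2 hyC
  rwa [← coe_erase] at this

/-- A largest set with the property `P`. -/
noncomputable def largestSet [Fintype E] (P : Finset E → Prop) : Finset E :=
  if h : (univ.filter P).Nonempty then (exists_max_image (univ.filter P) card h).choose else ∅

theorem largestSet_spec [Fintype E] {P : Finset E → Prop} {D : Finset E} (hD : P D) :
    P (largestSet P) ∧ #D ≤ #(largestSet P) := by
  have h : (univ.filter P).Nonempty := ⟨D, mem_filter.2 ⟨mem_univ _, hD⟩⟩
  rw [largestSet, dif_pos h]
  have hs := (exists_max_image (univ.filter P) card h).choose_spec
  exact ⟨(mem_filter.1 hs.1).2, hs.2 D (mem_filter.2 ⟨mem_univ _, hD⟩)⟩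

end Certificates

/-! ### The one-round algorithm. -/

section Algorithm

open Classical

variable {E : Type} [Fintype E] (S : Finset E)

/-- The random seeds: blocks of uniformly random orderings of `S`. -/
abbrev OrderingBlocks : Type :=
  Fin (Fintype.card E ^ 6) → Fin (Fintype.card E) → (Fin #S ≃ {x : E // x ∈ S})

variable {S}

/-- The sets consisting of an initial segment of a sampled ordering and one more element. -/
noncomputable def testSets (ω : OrderingBlocks S) : Finset (Finset E) :=
  univ.image fun p : (Fin (Fintype.card E ^ 6) × Fin (Fintype.card E)) ×
      (Fin (Fintype.card E + 1) × E) =>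
    insert p.2.2 (initialSeg (ω p.1.1 p.1.2) p.2.1)

/-- These are all the sets whose answers can enter `Certified` for the family `testSets ω`. -/
noncomputable def querySets (ω : OrderingBlocks S) : Finset (Finset E) :=
  testSets ω ∪ (testSets ω ×ˢ univ).image fun p => p.1.erase p.2

theorem card_querySets_le (ω : OrderingBlocks S) (hn : 2 ≤ Fintype.card E) :
    #(querySets ω) ≤ Fintype.card E ^ 12 := by
  set n := Fintype.card E with hnd
  have h1 : #(testSets ω) ≤ n ^ 6 * n * ((n + 1) * n) := by
    refine card_image_le.trans_eq ?_
    rw [card_univ, Fintype.card_prod, Fintype.card_prod, Fintype.card_prod, Fintype.card_fin,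
      Fintype.card_fin, Fintype.card_fin]
  have h2 : #((testSets ω ×ˢ (univ : Finset E)).image fun p => p.1.erase p.2) ≤
      #(testSets ω) * n := by
    refine card_image_le.trans_eq ?_
    rw [card_product, card_univ]
  have h3 : n + 1 ≤ n ^ 2 := by nlinarith
  calc #(querySets ω) ≤ #(testSets ω) + #(testSets ω) * n :=
        (card_union_le _ _).trans (Nat.add_le_add_left h2 _)
    _ = #(testSets ω) * (n + 1) := by ring
    _ ≤ n ^ 6 * n * ((n + 1) * n) * (n + 1) := Nat.mul_le_mul_right _ h1
    _ ≤ n ^ 6 * n * (n ^ 2 * n) * n ^ 2 := by gcongr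
    _ = n ^ 12 := by ring

variable (S)

/-- Query all test sets and all sets obtained from them by removing one element, and return a
largest certified set. -/
noncomputable def certifyingAlgorithm : OneRoundAlgorithm E where
  Seed := OrderingBlocks S
  seedFintype := inferInstance
  seedNonempty := ⟨fun _ _ => (nonempty_ordering S).some⟩
  queries := querySets
  output ω ans := largestSet (Certified
    (fun Q => if h : Q ∈ querySets ω then ans ⟨Q, h⟩ = true else False) (testSets ω) S)

variable {S}

/-- The analysis need only exhibit some certified `D`: by maximality the output is at least as
large, whatever `D` the analysis picks. -/
theorem certifyingAlgorithm_run (M : Matroid E) (ω : OrderingBlocks S) {D : Finset E}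
    (hD : Certified (fun Q => M.Indep (Q : Set E)) (testSets ω) S D) :
    Certified (fun Q => M.Indep (Q : Set E)) (testSets ω) S ((certifyingAlgorithm S).run M ω) ∧
      #D ≤ #((certifyingAlgorithm S).run M ω) := by
  set ans : Finset E → Prop := fun Q =>
    if h : Q ∈ querySets ω then indOracle M Q = true else False with hans
  have hq : ∀ Q ∈ querySets ω, M.Indep (Q : Set E) ↔ ans Q := by
    intro Q hQ
    simp [hans, hQ, indOracle]
  have hW : ∀ W ∈ testSets ω, M.Indep (W : Set E) ↔ ans W := fun W hW =>
    hq W (mem_union_left _ hW)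
  have hWx : ∀ W ∈ testSets ω, ∀ x, M.Indep ((W.erase x : Finset E) : Set E) ↔ ans (W.erase x) :=
    fun W hW x => hq _ (mem_union_right _
      (mem_image.2 ⟨(W, x), mem_product.2 ⟨hW, mem_univ _⟩, rfl⟩))
  have hrun : (certifyingAlgorithm S).run M ω = largestSet (Certified ans (testSets ω) S) := rfl
  obtain ⟨h1, h2⟩ := largestSet_spec (P := Certified ans (testSets ω) S) (hD.congr hW hWx)
  rw [hrun]
  exact ⟨h1.congr (fun W h => (hW W h).symm) (fun W h x => (hWx W h x).symm), h2⟩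

/-- With probability at least `1 - 2⁻ⁿ`, the samples certify a set of at least `τ` redundant
elements. -/
def CertifiesWhp (M : Matroid E) (S : Finset E) (τ : ℝ) : Prop :=
  1 - (1 / 2 : ℝ) ^ Fintype.card E ≤ uniformProb (OrderingBlocks S) fun ω =>
    ∃ D, Certified (fun Q => M.Indep (Q : Set E)) (testSets ω) S D ∧ τ ≤ #D

theorem CertifiesWhp.mono {M : Matroid E} {τ τ' : ℝ} (h : CertifiesWhp M S τ) (hτ : τ' ≤ τ) :
    CertifiesWhp M S τ' :=
  le_trans h (uniformProb_mono fun _ ⟨D, hD, hτD⟩ => ⟨D, hD, hτ.trans hτD⟩)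

theorem mem_testSets {ω : OrderingBlocks S} (a : Fin (Fintype.card E ^ 6))
    (b : Fin (Fintype.card E)) {j : ℕ} (hj : j ≤ Fintype.card E) (x : E) :
    insert x (initialSeg (ω a b) j) ∈ testSets ω :=
  mem_image.2 ⟨((a, b), (⟨j, Nat.lt_succ_of_le hj⟩, x)), mem_univ _, rfl⟩

/-- A family of sampled first circuits, each of which meets `D` in the prescribed element,
certifies `D`. -/
theorem certified_of_isFirstCircuit {M : Matroid E} (hM : M.E = Set.univ) {ω : OrderingBlocks S}
    {D : Finset E} (hDS : D ⊆ S)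
    (h : ∀ x ∈ D, ∃ a b C, IsFirstCircuit M (ω a b) C ∧ x ∈ C ∧ ∀ d ∈ D, d ≠ x → d ∉ C) :
    Certified (fun Q => M.Indep (Q : Set E)) (testSets ω) S D := by
  refine ⟨hDS, fun x hx => ?_⟩
  obtain ⟨a, b, C, ⟨j, hI, hC, hCs⟩, hxC, hd⟩ := h x hx
  rw [← coe_initialSeg] at hI hCs
  have hj : j < #S := by
    by_contra hj
    push Not at hj
    rw [initialSeg_of_card_le _ (by omega : #S ≤ j + 1)] at hCs
    rw [initialSeg_of_card_le _ hj] at hI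
    exact Matroid.not_indep_of_isCircuit_subset hC hCs hI
  have key := indep_initialSeg_sdiff_iff hM hI hC hCs
  have hxW : x ∈ initialSeg (ω a b) (j + 1) := mem_coe.1 (hCs hxC)
  refine ⟨initialSeg (ω a b) (j + 1), ?_, initialSeg_subset _ _, hxW,
    Matroid.not_indep_of_isCircuit_subset hC hCs, ?_, fun d hdD _ hne hind => ?_⟩
  -- The segment itself is a test set, since inserting `x`, already present, changes nothing.
  · have := mem_testSets (ω := ω) a b (j := j + 1) (by have := card_le_univ S; omega) x
    rwa [insert_eq_self.2 hxW] at this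
  · have := (key x).2 hxC
    rwa [← coe_erase] at this
  · exact hd d hdD hne ((key d).1 (by rwa [← coe_erase]))

theorem orderingBlocks_nonempty : Nonempty (OrderingBlocks S) :=
  ⟨fun _ _ => (nonempty_ordering S).some⟩

/-- Any single element of any sampled first circuit is certified. This settles targets up to 1, so
the other arguments may assume larger ones. -/
theorem CertifiesWhp.of_le_one {M : Matroid E} (hM : M.E = Set.univ)
    (hS : ¬ M.Indep (S : Set E)) (hn : 0 < Fintype.card E) {τ : ℝ} (hτ : τ ≤ 1) :
    CertifiesWhp M S τ := by
  have := orderingBlocks_nonempty (S := S)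
  rw [CertifiesWhp, uniformProb_true]
  · linarith [show (0 : ℝ) ≤ (1 / 2 : ℝ) ^ Fintype.card E by positivity]
  · intro ω
    let a : Fin (Fintype.card E ^ 6) := ⟨0, by positivity⟩
    let b : Fin (Fintype.card E) := ⟨0, hn⟩
    obtain ⟨C, hC⟩ := exists_isFirstCircuit hM hS (ω a b)
    obtain ⟨j, -, hCc, hCs⟩ := id hC
    obtain ⟨x, hx⟩ := hCc.nonempty
    have hxS : x ∈ S := by
      rw [← coe_initialSeg] at hCs
      exact initialSeg_subset _ _ (mem_coe.1 (hCs hx))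
    refine ⟨{x}, certified_of_isFirstCircuit hM (by simpa using hxS) fun y hy => ?_, by simpa⟩
    rw [mem_singleton] at hy
    subst hy
    exact ⟨a, b, C, hC, hx, fun d hd hne => absurd (mem_singleton.1 hd) hne⟩

theorem CertifiesWhp.of_fail {M : Matroid E} {τ : ℝ} {F : OrderingBlocks S → Prop}
    (h : ∀ ω, ¬ F ω → ∃ D, Certified (fun Q => M.Indep (Q : Set E)) (testSets ω) S D ∧ τ ≤ #D)
    (hF : uniformProb (OrderingBlocks S) F ≤ (1 / 2) ^ Fintype.card E) : CertifiesWhp M S τ := by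
  have := orderingBlocks_nonempty (S := S)
  have h1 := uniformProb_mono h
  rw [uniformProb_not] at h1
  rw [CertifiesWhp]
  linarith

end Algorithm

/-! ### Certificates from circuits with few elements in `X`. -/

section SmallIntersections

open Classical

variable {E : Type} [Fintype E] {S : Finset E}

/-- If every large part of `X` is hit reasonably often by first circuits that have at most `Λ`
elements in `X`, then a `1 / (2Λ + 1)` fraction of `X` is certified. -/
theorem CertifiesWhp.of_hits {M : Matroid E} (hM : M.E = Set.univ) {X : Finset E} (hXS : X ⊆ S)
    (hX : #S ≤ 2 * #X) (d : ℕ) (p : ℝ)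
    (hp : ∀ T ⊆ X, #S ≤ 4 * #T → p ≤ uniformProb (Fin #S ≃ {x : E // x ∈ S}) fun σ =>
      ∃ C, IsFirstCircuit M σ C ∧ (∃ x ∈ T, x ∈ C) ∧ #(X.filter (· ∈ C)) ≤ d)
    (hn : (2 : ℝ) ^ Fintype.card E * (1 - p) ^ Fintype.card E ^ 7 ≤ (1 / 2) ^ Fintype.card E) :
    CertifiesWhp M S (#S / (4 * (2 * d + 1))) := by
  have := nonempty_ordering S
  set hit : Finset E → (Fin #S ≃ {x : E // x ∈ S}) → Prop := fun T σ =>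
    ∃ C, IsFirstCircuit M σ C ∧ (∃ x ∈ T, x ∈ C) ∧ #(X.filter (· ∈ C)) ≤ d with hhit
  set Ts := X.powerset.filter fun T => #S ≤ 4 * #T with hTs
  refine CertifiesWhp.of_fail (F := fun ω => ∃ T ∈ Ts, ∀ a b, ¬ hit T (ω a b)) ?_ ?_
  · intro ω hω
    push Not at hω
    set V := X.filter fun x => ∃ a b C, IsFirstCircuit M (ω a b) C ∧ x ∈ C ∧
      #(X.filter (· ∈ C)) ≤ d with hV
    -- Otherwise `X \ V` has at least a quarter of the size of `S` and is hit by a sampled small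
    -- circuit, whose element there would belong to `V`.
    have hVc : #S ≤ 4 * #V := by
      by_contra hlt
      have hsum : #(X \ V) + #V = #X := card_sdiff_add_card_eq_card (filter_subset _ _)
      obtain ⟨a, b, C, hC, ⟨x, hx, hxC⟩, hd⟩ := hω (X \ V)
        (mem_filter.2 ⟨mem_powerset.2 sdiff_subset, by omega⟩)
      rw [mem_sdiff] at hx
      exact hx.2 (mem_filter.2 ⟨hx.1, a, b, C, hC, hxC, hd⟩)
    have hex : ∀ x : E, ∃ C : Set E, x ∈ V → (∃ a b, IsFirstCircuit M (ω a b) C) ∧ x ∈ C ∧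
        #(X.filter (· ∈ C)) ≤ d := by
      intro x
      by_cases hx : x ∈ V
      · obtain ⟨-, a, b, C, h1, h2, h3⟩ := mem_filter.1 hx
        exact ⟨C, fun _ => ⟨⟨a, b, h1⟩, h2, h3⟩⟩
      · exact ⟨∅, fun h => absurd h hx⟩
    choose C hC using hex
    obtain ⟨D, hDV, hDc, hD⟩ := exists_independent_of_outdegree_le
      (fun x => X.filter (· ∈ C x)) d V fun x hx => (hC x hx).2.2
    have hVX : V ⊆ X := filter_subset _ _
    refine ⟨D, certified_of_isFirstCircuit hM (hDV.trans (hVX.trans hXS)) fun x hx => ?_, ?_⟩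
    · obtain ⟨⟨a, b, hab⟩, hxC, -⟩ := hC x (hDV hx)
      exact ⟨a, b, C x, hab, hxC, fun y hy hyx hyC =>
        hD x hx y hy hyx (mem_filter.2 ⟨hVX (hDV hy), hyC⟩)⟩
    · rw [div_le_iff₀ (by positivity)]
      have : #S ≤ #D * (4 * (2 * d + 1)) := by nlinarith
      exact_mod_cast this
  · have hfail : ∀ T ∈ Ts, uniformProb (OrderingBlocks S) (fun ω => ∀ a b, ¬ hit T (ω a b)) ≤
        (1 - p) ^ Fintype.card E ^ 7 := by
      intro T hT
      rw [hTs, mem_filter, mem_powerset] at hT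
      rw [uniformProb_pi_const (fun f : Fin (Fintype.card E) → (Fin #S ≃ {x : E // x ∈ S}) =>
          ∀ b, ¬ hit T (f b)), uniformProb_pi_const (fun σ => ¬ hit T σ), Fintype.card_fin,
        Fintype.card_fin, ← pow_mul, show Fintype.card E * Fintype.card E ^ 6 =
          Fintype.card E ^ 7 by ring]
      have h1 := hp T hT.1 hT.2
      have h2 := uniformProb_not (hit T)
      have h3 := uniformProb_nonneg (fun σ => ¬ hit T σ)
      gcongr
      rw [h2]
      exact sub_le_sub_left h1 1
    have hunion := uniformProb_le_sum Ts
      (fun ω : OrderingBlocks S => ∃ T ∈ Ts, ∀ a b, ¬ hit T (ω a b))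
      (fun T ω => ∀ a b, ¬ hit T (ω a b)) fun ω h => h
    refine hunion.trans ((sum_le_sum hfail).trans ?_)
    rw [sum_const, nsmul_eq_mul]
    refine le_trans ?_ hn
    -- The sign of `1 - p` is not known; the power is nonnegative because it bounds a failure
    -- probability for some `T ∈ Ts`, and `X` itself is in `Ts`.
    rcases Ts.eq_empty_or_nonempty with h | ⟨T, hT⟩
    · by_cases hneg : 0 ≤ (1 - p) ^ Fintype.card E ^ 7
      · rw [h]; simp only [card_empty, Nat.cast_zero, zero_mul]; positivity
      · exfalso
        have hXX : X ∈ Ts := mem_filter.2 ⟨mem_powerset_self X, by omega⟩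
        rw [h] at hXX
        simp at hXX
    · have hpos : 0 ≤ (1 - p) ^ Fintype.card E ^ 7 := (uniformProb_nonneg _).trans (hfail T hT)
      gcongr
      have : #Ts ≤ 2 ^ Fintype.card E :=
        (card_filter_le _ _).trans ((card_powerset X).trans_le
          (Nat.pow_le_pow_right (by norm_num) (card_le_univ X)))
      exact_mod_cast this

end SmallIntersections

/-! ### Certificates from spanned elements in a block of orderings. -/

section Blocks

open Classical

variable {E : Type} [Fintype E] {S : Finset E}

/-- By Bernoulli `(1 + 1/n)^n ≥ 2`, and its product with the left side is at most 1. -/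
theorem one_sub_one_div_pow_le_half {n : ℕ} (hn : 0 < n) : (1 - 1 / n : ℝ) ^ n ≤ 1 / 2 := by
  have hnpos : (0 : ℝ) < n := by exact_mod_cast hn
  have h0 : (0 : ℝ) ≤ 1 / n := by positivity
  have h1 : (1 : ℝ) / n ≤ 1 := by rw [div_le_one hnpos]; exact_mod_cast hn
  have h2 : (1 : ℝ) + n * (1 / n) ≤ (1 + 1 / n) ^ n := one_add_mul_le_pow (by linarith) n
  rw [mul_one_div_cancel hnpos.ne'] at h2
  have h3 : (1 - 1 / n : ℝ) ^ n * (1 + 1 / n) ^ n ≤ 1 := by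
    rw [← mul_pow]
    exact pow_le_one₀ (by nlinarith) (by nlinarith [sq_nonneg (1 / (n : ℝ))])
  have h4 : 0 ≤ (1 - 1 / n : ℝ) ^ n := pow_nonneg (by linarith) _
  nlinarith

/-- Here `a` stands for the probability that `x` avoids the prefix of one ordering and `q` for the
probability that it is moreover spanned. Since `(a - q)(1 + q) ≤ a`, Bernoulli applied to `(1 +
q)^g` suffices. -/
theorem pow_mul_le_pow_sub_pow {a q : ℝ} (hq : 0 ≤ q) (hqa : q ≤ a) (ha : a ≤ 1) (g : ℕ) :
    a ^ g * (g * q / (1 + g * q)) ≤ a ^ g - (a - q) ^ g := by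
  have hb : (1 + g * q : ℝ) ≤ (1 + q) ^ g := one_add_mul_le_pow (by linarith) g
  have h1 : (a - q) ^ g * (1 + g * q) ≤ a ^ g := by
    calc (a - q) ^ g * (1 + g * q) ≤ (a - q) ^ g * (1 + q) ^ g := by
          have : 0 ≤ (a - q) ^ g := pow_nonneg (by linarith) _
          gcongr
      _ = ((a - q) * (1 + q)) ^ g := (mul_pow _ _ _).symm
      _ ≤ a ^ g := by
          have : 0 ≤ (a - q) * (1 + q) := mul_nonneg (by linarith) (by linarith)
          gcongr
          nlinarith
  have hpos : (0 : ℝ) < 1 + g * q := by positivity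
  rw [mul_div_assoc', div_le_iff₀ hpos]
  nlinarith

/-- A lower bound for the expected number of elements of `X` that lie outside the first `K`
elements of each of the first `g` orderings of a block and are spanned by an independent initial
segment of one of them; all these elements are certified. -/
theorem CertifiesWhp.of_blocks {M : Matroid E} (hM : M.E = Set.univ)
    (hS : ¬ M.Indep (S : Set E)) (hn2 : 2 ≤ Fintype.card E)
    {X : Finset E} (hXS : X ⊆ S) {K g : ℕ} (hK : K ≤ #S) (hg : g ≤ Fintype.card E) {τ : ℝ}
    (hτ : τ ≤ (∑ x ∈ X, (1 - (K : ℝ) / #S) ^ g *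
      (g * uniformProb (Fin #S ≃ {x : E // x ∈ S}) (SpannedEarly M K x) /
        (1 + g * uniformProb (Fin #S ≃ {x : E // x ∈ S}) (SpannedEarly M K x)))) / 2) :
    CertifiesWhp M S τ := by
  rcases le_or_gt τ 1 with hτ1 | hτ1
  · exact CertifiesWhp.of_le_one hM hS (by omega) hτ1
  have := nonempty_ordering S
  set n := Fintype.card E with hn
  set μ := ∑ x ∈ X, (1 - (K : ℝ) / #S) ^ g *
      (g * uniformProb (Fin #S ≃ {x : E // x ∈ S}) (SpannedEarly M K x) /
        (1 + g * uniformProb (Fin #S ≃ {x : E // x ∈ S}) (SpannedEarly M K x))) with hμ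
  have hXpos : 0 < #X := by
    rw [card_pos]
    by_contra h
    rw [not_nonempty_iff_eq_empty] at h
    rw [hμ, h, sum_empty] at hτ
    linarith
  have hSpos : (0 : ℝ) < #S := by exact_mod_cast hXpos.trans_le (card_le_card hXS)
  -- A difference of two product events, so that its probability is `a ^ g - (a - q) ^ g`.
  set Q : E → (Fin n → (Fin #S ≃ {x : E // x ∈ S})) → Prop := fun x f =>
    (∀ i : Fin n, (i : ℕ) < g → x ∉ initialSeg (f i) K) ∧
    ¬ (∀ i : Fin n, (i : ℕ) < g → x ∉ initialSeg (f i) K ∧ ¬ SpannedEarly M K x (f i)) with hQ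
  have hprob : μ ≤ ∑ x ∈ X, uniformProb _ (Q x) := by
    refine sum_le_sum fun x hx => ?_
    set q := uniformProb (Fin #S ≃ {x : E // x ∈ S}) (SpannedEarly M K x) with hq
    set a := uniformProb (Fin #S ≃ {x : E // x ∈ S}) (fun σ => x ∉ initialSeg σ K) with ha
    have h1 : uniformProb _ (Q x) = a ^ g - (a - q) ^ g := by
      rw [hQ, uniformProb_and_not (fun f h i hi => (h i hi).1),
        uniformProb_pi_initial hg (fun σ => x ∉ initialSeg σ K),
        uniformProb_pi_initial hg (fun σ => x ∉ initialSeg σ K ∧ ¬ SpannedEarly M K x σ),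
        uniformProb_and_not (fun σ h => h.1)]
    have h2 : 1 - (K : ℝ) / #S ≤ a := by
      rw [ha, uniformProb_not]
      have := uniformProb_mem_initialSeg_le hK x
      gcongr
      rw [le_div_iff₀ hSpos]
      linarith
    have h3 : q ≤ a := uniformProb_mono fun σ h => h.1
    have h4 : 0 ≤ q := uniformProb_nonneg _
    have h5 : 0 ≤ 1 - (K : ℝ) / #S := by
      rw [sub_nonneg, div_le_one hSpos]; exact_mod_cast hK
    rw [h1]
    refine le_trans ?_ (pow_mul_le_pow_sub_pow h4 h3 (uniformProb_le_one _) g)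
    gcongr
  set good : (Fin n → (Fin #S ≃ {x : E // x ∈ S})) → Prop := fun f =>
    μ / 2 ≤ #(X.filter fun x => Q x f) with hgood
  refine CertifiesWhp.of_fail (F := fun ω => ∀ a, ¬ good (ω a)) ?_ ?_
  · intro ω hω
    push Not at hω
    obtain ⟨a, hD⟩ := hω
    refine ⟨X.filter fun x => Q x (ω a), ⟨(filter_subset _ _).trans hXS, ?_⟩, hτ.trans hD⟩
    intro x hx
    obtain ⟨hx1, hx2⟩ := (mem_filter.1 hx).2
    push Not at hx2
    obtain ⟨i, hi, hsp⟩ := hx2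
    obtain ⟨hxK, j, hj, hI, hdep⟩ := hsp (hx1 i hi)
    have hxj : x ∉ initialSeg (ω a i) j := fun h => hxK (initialSeg_mono _ hj.le h)
    have hSn : #S ≤ n := card_le_univ S
    refine ⟨insert x (initialSeg (ω a i) j), mem_testSets a i (by omega) x,
      insert_subset (hXS (mem_filter.1 hx).1) (initialSeg_subset _ _), mem_insert_self _ _,
      fun h => hdep (by rwa [← coe_insert]), by rwa [erase_insert hxj], fun d hd hdW hne => ?_⟩
    -- Another element of the set would lie in the first `K` positions, which all of them avoid.
    have hdj := mem_of_mem_insert_of_ne hdW hne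
    exact absurd (initialSeg_mono _ hj.le hdj) ((mem_filter.1 hd).2.1 i hi)
  · rw [uniformProb_pi_const (fun f => ¬ good f), Fintype.card_fin, uniformProb_not]
    have h1 := le_uniformProb_half_le_card X Q μ hprob
    have hXn : (#X : ℝ) ≤ n := by exact_mod_cast card_le_univ X
    have hnpos : (0 : ℝ) < n := by positivity
    have hp0 : 0 ≤ uniformProb _ good := uniformProb_nonneg _
    have hp1 : uniformProb _ good ≤ 1 := uniformProb_le_one _
    -- As `τ > 1`, also `μ / 2 > 1`, so reverse Markov makes a block good with probability at least
    -- `1 / n`; the `n ^ 6` blocks amplify this.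
    have hp : 1 / n ≤ uniformProb _ good := by
      rw [div_le_iff₀ hnpos]
      have : (1 : ℝ) ≤ #X * uniformProb _ good := by linarith
      nlinarith
    have hhalf := one_sub_one_div_pow_le_half (by omega : 0 < n)
    have h0 : 0 ≤ 1 - 1 / (n : ℝ) := by
      rw [sub_nonneg, div_le_one hnpos]; exact_mod_cast (by omega : 1 ≤ n)
    calc (1 - uniformProb _ good) ^ n ^ 6 ≤ (1 - 1 / n : ℝ) ^ n ^ 6 := by
          have : 0 ≤ 1 - uniformProb _ good := by linarith
          gcongr
      _ = ((1 - 1 / n : ℝ) ^ n) ^ n ^ 5 := by rw [← pow_mul]; congr 1; ring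
      _ ≤ (1 / 2) ^ n ^ 5 := by gcongr
      _ ≤ (1 / 2) ^ n := pow_le_pow_of_le_one (by norm_num) (by norm_num)
          (Nat.le_self_pow (by norm_num) n)

end Blocks

/-! ### Consequences of global optimality. -/

section Bounds

open Classical

variable {E : Type} [Fintype E] {S : Finset E} {M : Matroid E}

/-- For empty `S` the hitting condition is void, but circuits are nonempty, so the circuit mass
would vanish. -/
theorem GloballyOptimal.card_pos (h : GloballyOptimal M S) : 0 < #S := by
  rw [Finset.card_pos]
  by_contra hS
  rw [not_nonempty_iff_eq_empty] at hS
  have h1 := h.1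
  have h0 : circuitMass M Finset.univ S ≤ 0 := by
    rw [circuitMass, uniformProb_eq_card_filter, filter_false_of_mem]
    · rw [card_empty, Nat.cast_zero, zero_div]
    · rintro π - ⟨C, ⟨j, -, hC, -⟩, hCS⟩
      rw [hS, coe_empty, Set.subset_empty_iff] at hCS
      exact hC.nonempty.ne_empty hCS
  norm_num at h1
  linarith

theorem GloballyOptimal.not_indep (h : GloballyOptimal M S)
    (hL : 0 < Real.logb 2 (Fintype.card E)) : ¬ M.Indep (S : Set E) := by
  intro hI
  have hs : (0 : ℝ) < #S := by exact_mod_cast h.card_pos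
  have h1 : (0 : ℝ) < hitProb M S S := lt_of_lt_of_le (by positivity) (h.2 S subset_rfl)
  have h0 : hitProb M S S ≤ 0 := by
    rw [hitProb, uniformProb_eq_card_filter, filter_false_of_mem]
    · rw [card_empty, Nat.cast_zero, zero_div]
    · rintro π - ⟨C, ⟨j, -, hC, hCs⟩, -⟩
      rw [← coe_initialSeg] at hCs
      exact Matroid.not_indep_of_isCircuit_subset hC
        (hCs.trans (coe_subset.2 (initialSeg_subset _ _))) hI
  linarith

/-- If `X` is at least half of a globally optimal set `S`, then about `#S / ℓ` redundant elements
are certified, where `ℓ` is the expected number of elements of `X` in the first circuit. -/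
theorem GloballyOptimal.certifiesWhp_of_half (hM : M.E = Set.univ) (h : GloballyOptimal M S)
    (hn : 2 ^ 24 ≤ Fintype.card E) (hL : 1 ≤ Real.logb 2 (Fintype.card E))
    (hLn : Real.logb 2 (Fintype.card E) ≤ Fintype.card E)
    {X : Finset E} (hXS : X ⊆ S) (hX : #S ≤ 2 * #X) :
    0 < ∑ x ∈ X, marginalProb M S x ∧
    CertifiesWhp M S (#S / (2 ^ 28 * Real.logb 2 (Fintype.card E) *
      ∑ x ∈ X, marginalProb M S x)) := by
  have hSpos : (0 : ℝ) < #S := by exact_mod_cast h.card_pos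
  set L := Real.logb 2 (Fintype.card E) with hLdef
  set ℓ := ∑ x ∈ X, marginalProb M S x with hℓ
  have hL0 : 0 < L := by linarith
  have hXr : (#S : ℝ) ≤ 2 * #X := by exact_mod_cast hX
  have hℓ1 : 1 / (2 ^ 22 * L) ≤ ℓ := by
    refine le_trans ?_ ((h.2 X hXS).trans (hitProb_le_sum_marginalProb M S X))
    rw [div_le_div_iff₀ (by positivity) (by positivity)]
    nlinarith [mul_le_mul_of_nonneg_left hXr hL0.le]
  have hℓpos : 0 < ℓ := lt_of_lt_of_le (by positivity) hℓ1
  refine ⟨hℓpos, ?_⟩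
  -- By Markov more than `Λ` elements occur with probability at most `1 / (2 ^ 24 * L)`, half of the
  -- hitting probability of a set with `#S ≤ 4 * #T`.
  set Λ := 2 ^ 24 * L * ℓ with hΛ
  have hΛ4 : 4 ≤ Λ := by
    rw [div_le_iff₀ (by positivity)] at hℓ1
    rw [hΛ]; nlinarith
  have hd : (⌊Λ⌋₊ : ℝ) ≤ Λ := Nat.floor_le (by linarith)
  have key : CertifiesWhp M S (#S / (4 * (2 * (⌊Λ⌋₊ : ℕ) + 1))) := by
    refine CertifiesWhp.of_hits hM hXS hX ⌊Λ⌋₊ (1 / (2 ^ 24 * L)) ?_ ?_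
    · intro T hTX hT
      have hTr : (#S : ℝ) ≤ 4 * #T := by exact_mod_cast hT
      have hhit : 1 / (2 ^ 23 * L) ≤ hitProb M S T := by
        refine le_trans ?_ (h.2 T (hTX.trans hXS))
        rw [div_le_div_iff₀ (by positivity) (by positivity)]
        nlinarith [mul_le_mul_of_nonneg_left hTr hL0.le]
      have hsplit : hitProb M S T ≤ uniformProb (Fin #S ≃ {x : E // x ∈ S}) (fun σ =>
            ∃ C, IsFirstCircuit M σ C ∧ (∃ x ∈ T, x ∈ C) ∧ #(X.filter (· ∈ C)) ≤ ⌊Λ⌋₊) +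
          uniformProb (Fin #S ≃ {x : E // x ∈ S}) (fun σ =>
            ∃ C, IsFirstCircuit M σ C ∧ ⌊Λ⌋₊ < #(X.filter (· ∈ C))) := by
        refine uniformProb_le_add _ _ _ ?_
        rintro σ ⟨C, hC, x, hxT, hxC⟩
        rcases le_or_gt #(X.filter (· ∈ C)) ⌊Λ⌋₊ with h | h
        · exact Or.inl ⟨C, hC, ⟨x, hxT, hxC⟩, h⟩
        · exact Or.inr ⟨C, hC, h⟩
      have hmarkov : uniformProb (Fin #S ≃ {x : E // x ∈ S}) (fun σ =>
            ∃ C, IsFirstCircuit M σ C ∧ ⌊Λ⌋₊ < #(X.filter (· ∈ C))) * Λ ≤ ℓ := by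
        refine uniformProb_lt_card_mul_le X _ _ Λ ?_
        rintro σ ⟨C, hC, hlt⟩
        refine ⟨X.filter (· ∈ C), filter_subset _ _, fun x hx => ?_, ?_⟩
        · exact ⟨C, hC, x, by simp, (mem_filter.1 hx).2⟩
        · exact (Nat.lt_of_floor_lt hlt).le
      have hmarkov' : uniformProb (Fin #S ≃ {x : E // x ∈ S}) (fun σ =>
            ∃ C, IsFirstCircuit M σ C ∧ ⌊Λ⌋₊ < #(X.filter (· ∈ C))) ≤ 1 / (2 ^ 24 * L) := by
        rw [le_div_iff₀ (by positivity)]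
        rw [hΛ] at hmarkov
        refine le_of_mul_le_mul_right ?_ hℓpos
        linarith
      have : 1 / (2 ^ 23 * L) = 2 * (1 / (2 ^ 24 * L)) := by
        field_simp
      linarith
    · set n := Fintype.card E with hnd
      have hnr : (2 : ℝ) ^ 24 ≤ n := by exact_mod_cast hn
      -- Of the `n ^ 7` samples every `n ^ 2` halve the failure probability; the resulting
      -- `2^(-n^5)` beats the `2 ^ n` sets of the union bound.
      have hp : 1 / ((n ^ 2 : ℕ) : ℝ) ≤ 1 / (2 ^ 24 * L) := by
        push_cast
        refine one_div_le_one_div_of_le (by positivity) ?_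
        nlinarith
      have hp1 : 1 / (2 ^ 24 * L) ≤ 1 := by
        rw [div_le_one (by positivity)]; nlinarith
      have hhalf := one_sub_one_div_pow_le_half (n := n ^ 2) (by positivity)
      have h2 : 2 * n ≤ n ^ 5 := by
        calc 2 * n ≤ n ^ 4 * n := Nat.mul_le_mul_right _ ((by omega : 2 ≤ n).trans
              (Nat.le_self_pow (by norm_num) n))
          _ = n ^ 5 := by ring
      calc (2 : ℝ) ^ n * (1 - 1 / (2 ^ 24 * L)) ^ n ^ 7
          ≤ 2 ^ n * (1 - 1 / ((n ^ 2 : ℕ) : ℝ)) ^ n ^ 7 := by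
            have : 0 ≤ 1 - 1 / (2 ^ 24 * L) := by linarith
            gcongr
        _ = 2 ^ n * ((1 - 1 / ((n ^ 2 : ℕ) : ℝ)) ^ n ^ 2) ^ n ^ 5 := by
            rw [← pow_mul]; congr 2; ring
        _ ≤ 2 ^ n * (1 / 2) ^ n ^ 5 := by
            have : 0 ≤ (1 - 1 / ((n ^ 2 : ℕ) : ℝ)) ^ n ^ 2 :=
              pow_nonneg (by linarith) _
            gcongr
        _ ≤ 2 ^ n * (1 / 2) ^ (2 * n) := by
            have : (1 / 2 : ℝ) ^ n ^ 5 ≤ (1 / 2) ^ (2 * n) :=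
              pow_le_pow_of_le_one (by norm_num) (by norm_num) h2
            gcongr
        _ = (1 / 2) ^ n := by
            rw [two_mul, pow_add, ← mul_assoc, ← mul_pow]; norm_num
  refine key.mono ?_
  refine div_le_div_of_nonneg_left hSpos.le (by positivity) ?_
  rw [hΛ] at hd hΛ4
  nlinarith

theorem div_one_add_mono {y z : ℝ} (hy : 0 ≤ y) (hyz : y ≤ z) : y / (1 + y) ≤ z / (1 + z) := by
  rw [div_le_div_iff₀ (by linarith) (by linarith)]
  nlinarith

theorem half_le_div_one_add {y : ℝ} (hy : 0 ≤ y) (hy1 : y ≤ 1) : y / 2 ≤ y / (1 + y) :=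
  div_le_div_of_nonneg_left hy (by linarith) (by linarith)

/-- Since `y / (1 + y)` is increasing, the spanning probability in `CertifiesWhp.of_blocks` may be
replaced by the lower bound from `sub_mul_earlyProb_le`. -/
theorem CertifiesWhp.of_earlyProb (hM : M.E = Set.univ) (hS : ¬ M.Indep (S : Set E))
    (hn2 : 2 ≤ Fintype.card E) {X : Finset E} (hXS : X ⊆ S) {K g : ℕ} (hK0 : 0 < K) (hK : K ≤ #S)
    (hg : g ≤ Fintype.card E) {y : E → ℝ} (hy : ∀ x ∈ X, 0 ≤ y x)
    (hyK : ∀ x ∈ X, K * y x ≤ g * (((#S : ℝ) - K) * earlyProb M S K x)) {τ : ℝ}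
    (hτ : τ ≤ (1 - (K : ℝ) / #S) ^ g * (∑ x ∈ X, y x / (1 + y x)) / 2) :
    CertifiesWhp M S τ := by
  refine CertifiesWhp.of_blocks hM hS hn2 hXS hK hg (hτ.trans ?_)
  have hSpos : (0 : ℝ) < #S := by exact_mod_cast hK0.trans_le hK
  have hKpos : (0 : ℝ) < K := by exact_mod_cast hK0
  have h5 : 0 ≤ 1 - (K : ℝ) / #S := by
    rw [sub_nonneg, div_le_one hSpos]; exact_mod_cast hK
  rw [mul_sum]
  refine div_le_div_of_nonneg_right (sum_le_sum fun x hx =>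
    mul_le_mul_of_nonneg_left (div_one_add_mono (hy x hx) ?_) (pow_nonneg h5 g)) (by norm_num)
  have h1 := sub_mul_earlyProb_le hM hK x
  refine le_of_mul_le_mul_left ?_ hKpos
  calc K * y x ≤ g * (((#S : ℝ) - K) * earlyProb M S K x) := hyK x hx
    _ ≤ g * (K * uniformProb (Fin #S ≃ {x : E // x ∈ S}) (SpannedEarly M K x)) := by gcongr
    _ = _ := by ring

end Bounds

/-! ### The two ranges of `alphaValue`, and the bounds on and off the core. -/

section Regimes

open Classical

variable {E : Type} [Fintype E] {S : Finset E} {M : Matroid E}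

/-- The bound for `α(S)` within a logarithmic factor of `|S| / log n`. -/
theorem CertifiesWhp.of_alphaValue_large (hM : M.E = Set.univ) (hS : ¬ M.Indep (S : Set E))
    {L : ℝ} (hL : 24 ≤ L) (hLn : (2 : ℝ) ^ L = Fintype.card E) (hn2 : 2 ≤ Fintype.card E)
    (hα : L * alphaValue M S < #S) (hα' : #S ≤ 16 * L * alphaValue M S)
    {X : Finset E} (hXS : X ⊆ S) {τ : ℝ}
    (hτ : τ ≤ (∑ x ∈ X, marginalProb M S x - 4) / (2 ^ 10 * L ^ 2)) :
    CertifiesWhp M S τ := by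
  set α := alphaValue M S with hαd
  have hα0 : 0 < α := alphaValue_pos M S
  have hαr : (0 : ℝ) < α := by exact_mod_cast hα0
  have hL0 : 0 < L := by linarith
  have hSr : (0 : ℝ) < #S := by nlinarith
  have hαS : α ≤ #S := by
    have : (α : ℝ) ≤ #S := by nlinarith
    exact_mod_cast this
  -- The prefix has length `m * α`; the subtraction leaves at least `α ≥ #S / (16 * L)` positions
  -- after it, to which elements can be moved.
  set m := #S / α - 1 with hm
  have hq : L < ((#S / α : ℕ) : ℝ) + 1 := by
    have h1 := Nat.lt_div_mul_add (a := #S) hα0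
    have h2 : (#S : ℝ) < ((#S / α : ℕ) : ℝ) * α + α := by exact_mod_cast h1
    by_contra h
    push Not at h
    nlinarith
  have hq2 : 2 ≤ #S / α := by
    have : (1 : ℝ) < ((#S / α : ℕ) : ℝ) := by linarith
    exact_mod_cast this
  have hmα : m * α + α ≤ #S := by
    calc m * α + α = (m + 1) * α := by ring
      _ = (#S / α) * α := by rw [hm, Nat.sub_add_cancel (by omega)]
      _ ≤ #S := Nat.div_mul_le_self _ _
  have hmL : L - 2 ≤ m := by
    have : ((#S / α : ℕ) : ℝ) = m + 1 := by
      rw [hm]; push_cast [Nat.cast_sub (by omega : 1 ≤ #S / α)]; ring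
    linarith
  -- As `m ≥ L - 2`, the prefix is independent with probability at most `4 / n`, so all late
  -- circuits together cost at most 4.
  have hu : #S * prefixIndepProb M S (m * α) ≤ 4 := by
    have h1 := prefixIndepProb_mul_alphaValue_le M S hαS m
    have h2 : (1 / 2 : ℝ) ^ m * 2 ^ L ≤ 4 := by
      have : (2 : ℝ) ^ L ≤ 2 ^ ((m : ℝ) + 2) :=
        Real.rpow_le_rpow_of_exponent_le (by norm_num) (by linarith)
      rw [Real.rpow_add (by norm_num), Real.rpow_natCast] at this
      calc (1 / 2 : ℝ) ^ m * 2 ^ L ≤ (1 / 2 : ℝ) ^ m * (2 ^ m * 2 ^ (2 : ℝ)) := by gcongr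
        _ = 4 := by
          rw [← mul_assoc, ← mul_pow]; norm_num
    have hSn : (#S : ℝ) ≤ 2 ^ L := by rw [hLn]; exact_mod_cast card_le_univ S
    calc #S * prefixIndepProb M S (m * α) ≤ 2 ^ L * (1 / 2 : ℝ) ^ m := by
          have : 0 ≤ prefixIndepProb M S (m * α) := uniformProb_nonneg _
          gcongr
      _ ≤ 4 := by linarith
  have hmr : (m : ℝ) * α + α ≤ #S := by exact_mod_cast hmα
  have hKr : ((m * α : ℕ) : ℝ) = m * α := by push_cast; ring
  have h1L : α / (#S : ℝ) ≤ 1 - ((m * α : ℕ) : ℝ) / #S := by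
    rw [le_sub_iff_add_le, ← add_div, div_le_one hSr, hKr]; linarith
  have h2L : 1 / (16 * L) ≤ α / (#S : ℝ) := by
    rw [div_le_div_iff₀ (by positivity) hSr]; linarith
  have he0 : ∀ x, 0 ≤ earlyProb M S (m * α) x := fun x => uniformProb_nonneg _
  have he1 : ∀ x, earlyProb M S (m * α) x ≤ 1 := fun x => uniformProb_le_one _
  refine CertifiesWhp.of_earlyProb hM hS hn2 hXS (K := m * α) (g := 1)
    (y := fun x => earlyProb M S (m * α) x / (16 * L)) (Nat.mul_pos (by omega) hα0) (by omega)
    (by omega) (fun x _ => div_nonneg (he0 x) (by positivity)) (fun x _ => ?_) (hτ.trans ?_)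
  · have hKS : (m * α : ℝ) ≤ #S := by linarith
    rw [hKr, Nat.cast_one, one_mul, mul_div_assoc', div_le_iff₀ (by positivity)]
    have : (m * α : ℝ) ≤ (#S - m * α) * (16 * L) := by nlinarith
    nlinarith [mul_le_mul_of_nonneg_right this (he0 x)]
  · rw [pow_one]
    have hsum : ∑ x ∈ X, marginalProb M S x - 4 ≤ ∑ x ∈ X, earlyProb M S (m * α) x := by
      have h1 := sum_le_sum fun x (_ : x ∈ X) => marginalProb_le M S (m * α) x
      rw [sum_add_distrib, sum_const, nsmul_eq_mul] at h1
      have h2 : (#X : ℝ) * prefixIndepProb M S (m * α) ≤ #S * prefixIndepProb M S (m * α) := by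
        have : 0 ≤ prefixIndepProb M S (m * α) := uniformProb_nonneg _
        have : (#X : ℝ) ≤ #S := by exact_mod_cast card_le_card hXS
        gcongr
      linarith
    have hy : (∑ x ∈ X, earlyProb M S (m * α) x) / (32 * L) ≤
        ∑ x ∈ X, earlyProb M S (m * α) x / (16 * L) / (1 + earlyProb M S (m * α) x / (16 * L)) := by
      rw [sum_div]
      refine sum_le_sum fun x _ => ?_
      refine le_trans (le_of_eq ?_) (half_le_div_one_add (div_nonneg (he0 x) (by positivity)) ?_)
      · field_simp; ring
      · rw [div_le_one (by positivity)]; linarith [he1 x]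
    have hE0 : 0 ≤ ∑ x ∈ X, earlyProb M S (m * α) x := sum_nonneg fun x _ => he0 x
    calc (∑ x ∈ X, marginalProb M S x - 4) / (2 ^ 10 * L ^ 2)
        ≤ (∑ x ∈ X, earlyProb M S (m * α) x) / (2 ^ 10 * L ^ 2) := by gcongr
      _ = 1 / (16 * L) * ((∑ x ∈ X, earlyProb M S (m * α) x) / (32 * L)) / 2 := by
          field_simp; ring
      _ ≤ _ := by
          have := h2L.trans h1L
          have : 0 ≤ 1 - ((m * α : ℕ) : ℝ) / #S := le_trans (by positivity) this
          gcongr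

/-- The bound for `α(S)` smaller than `|S| / log n` by a constant factor. -/
theorem CertifiesWhp.of_alphaValue_small (hM : M.E = Set.univ) (hS : ¬ M.Indep (S : Set E))
    {L : ℝ} (hL : 24 ≤ L) (hn2 : 2 ≤ Fintype.card E) (hα : 16 * L * alphaValue M S < #S)
    {X : Finset E} (hXS : X ⊆ S) {K : ℕ} (hK0 : 0 < K) (hK : K ≤ 5 * L * alphaValue M S) {τ : ℝ}
    (hτ : τ ≤ (∑ x ∈ X, (#S : ℝ) ^ 2 / (200 * L ^ 2 * (alphaValue M S : ℝ) ^ 2) *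
        earlyProb M S K x /
      (1 + (#S : ℝ) ^ 2 / (200 * L ^ 2 * (alphaValue M S : ℝ) ^ 2) * earlyProb M S K x)) / 4) :
    CertifiesWhp M S τ := by
  set α := alphaValue M S with hαd
  have hα0 : 0 < α := alphaValue_pos M S
  have hαr : (0 : ℝ) < α := by exact_mod_cast hα0
  have hL0 : 0 < L := by linarith
  have hSr : (0 : ℝ) < #S := lt_of_le_of_lt (by positivity) hα
  have hKr : (0 : ℝ) < K := by exact_mod_cast hK0
  have hKS : 2 * (K : ℝ) ≤ #S := by nlinarith
  have hKSn : 2 * K ≤ #S := by exact_mod_cast hKS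
  have hgle : #S / (2 * K) ≤ #S := Nat.div_le_self _ _
  have hg1 : 1 ≤ #S / (2 * K) := (Nat.one_le_div_iff (by omega)).2 hKSn
  -- Then `g * K / #S ≤ 1/2`, and Bernoulli lets an element avoid all `g` prefixes with probability
  -- at least 1/2.
  set g := #S / (2 * K) with hg
  have hgK : (g : ℝ) * (2 * K) ≤ #S := by exact_mod_cast Nat.div_mul_le_self #S (2 * K)
  have hgK' : (#S : ℝ) ≤ g * (4 * K) := by
    have h1 := Nat.lt_div_mul_add (a := #S) (b := 2 * K) (by omega)
    rw [← hg] at h1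
    have h2 : (#S : ℝ) < g * (2 * K) + 2 * K := by exact_mod_cast h1
    have h3 : (1 : ℝ) ≤ g := by exact_mod_cast hg1
    nlinarith
  have he0 : ∀ x, 0 ≤ earlyProb M S K x := fun x => uniformProb_nonneg _
  set c := (#S : ℝ) ^ 2 / (200 * L ^ 2 * (α : ℝ) ^ 2) with hc
  have hc0 : 0 ≤ c := by positivity
  -- The constant 200 is 8 · 5², from `g ≥ #S / (4K)`, `#S - K ≥ #S / 2` and `K ≤ 5Lα`.
  have hKc : K * c ≤ g * ((#S : ℝ) - K) := by
    have h1 : c ≤ (#S : ℝ) ^ 2 / (8 * K ^ 2) := by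
      refine div_le_div_of_nonneg_left (by positivity) (by positivity) ?_
      have : (K : ℝ) ^ 2 ≤ (5 * L * α) ^ 2 := by gcongr
      nlinarith
    calc K * c ≤ K * ((#S : ℝ) ^ 2 / (8 * K ^ 2)) := by gcongr
      _ = (#S / (4 * K)) * (#S / 2) := by field_simp; norm_num
      _ ≤ g * ((#S : ℝ) - K) := by
          refine mul_le_mul ?_ (by linarith) (by positivity) (by positivity)
          rwa [div_le_iff₀ (by positivity)]
  refine CertifiesWhp.of_earlyProb hM hS hn2 hXS (K := K) (g := g)
    (y := fun x => c * earlyProb M S K x) hK0 (by omega) (hgle.trans (card_le_univ S))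
    (fun x _ => mul_nonneg hc0 (he0 x)) (fun x _ => ?_) (hτ.trans ?_)
  · rw [← mul_assoc, ← mul_assoc]
    exact mul_le_mul_of_nonneg_right hKc (he0 x)
  · have hpow : (1 / 2 : ℝ) ≤ (1 - (K : ℝ) / #S) ^ g := by
      have h1 : (K : ℝ) / #S ≤ 1 := by rw [div_le_one hSr]; linarith
      have h2 := one_add_mul_le_pow (a := -((K : ℝ) / #S)) (by linarith) g
      rw [← sub_eq_add_neg] at h2
      have h3 : (g : ℝ) * (K / #S) ≤ 1 / 2 := by
        rw [mul_div_assoc', div_le_iff₀ hSr]; linarith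
      linarith
    have hsum : 0 ≤ ∑ x ∈ X, c * earlyProb M S K x / (1 + c * earlyProb M S K x) :=
      sum_nonneg fun x _ => by have := mul_nonneg hc0 (he0 x); positivity
    calc _ = 1 / 2 * (∑ x ∈ X, c * earlyProb M S K x / (1 + c * earlyProb M S K x)) / 2 := by ring
      _ ≤ _ := by gcongr

/-- A prefix of about `4 α(S) log n` elements is independent with probability at most `n⁻⁴`. -/
theorem exists_prefixIndepProb_le {L : ℝ} (hL : 24 ≤ L) (hLn : (2 : ℝ) ^ L = Fintype.card E)
    (hα : 16 * L * alphaValue M S < #S) :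
    ∃ K : ℕ, 0 < K ∧ K ≤ 5 * L * alphaValue M S ∧
      prefixIndepProb M S K * (Fintype.card E : ℝ) ^ 4 ≤ 1 := by
  set α := alphaValue M S with hαd
  have hα0 : 0 < α := alphaValue_pos M S
  have hαr : (0 : ℝ) < α := by exact_mod_cast hα0
  have hαS : α ≤ #S := by
    have : (α : ℝ) ≤ #S := by nlinarith
    exact_mod_cast this
  set m := ⌈4 * L⌉₊ with hm
  have hm1 : 4 * L ≤ m := Nat.le_ceil _
  have hm2 : (m : ℝ) ≤ 5 * L := by
    have := Nat.ceil_lt_add_one (a := 4 * L) (by linarith)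
    linarith
  have hm0 : 0 < m := by
    have : (0 : ℝ) < m := by linarith
    exact_mod_cast this
  refine ⟨m * α, Nat.mul_pos hm0 hα0, by push_cast; gcongr, ?_⟩
  have h1 := prefixIndepProb_mul_alphaValue_le M S hαS m
  have h2 : (Fintype.card E : ℝ) ^ 4 ≤ 2 ^ m := by
    rw [← hLn, ← Real.rpow_natCast, ← Real.rpow_mul (by norm_num), ← Real.rpow_natCast]
    refine Real.rpow_le_rpow_of_exponent_le (by norm_num) ?_
    push_cast; linarith
  calc prefixIndepProb M S (m * α) * (Fintype.card E : ℝ) ^ 4 ≤ (1 / 2) ^ m * 2 ^ m := by gcongr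
    _ = 1 := by rw [← mul_pow]; norm_num

variable {L : ℝ}

/-- About `ℓ |S|² / α(S)²` redundant elements are certified. -/
theorem CertifiesWhp.of_nonCoreMass (hM : M.E = Set.univ)
    (hS : ¬ M.Indep (S : Set E)) (hL : 24 ≤ L) (hLn : (2 : ℝ) ^ L = Fintype.card E)
    (hn2 : 2 ≤ Fintype.card E) (hα : L * alphaValue M S < #S) :
    CertifiesWhp M S (1 / 2 ^ 30 / L ^ 4 *
      min (#S : ℝ) (nonCoreMass M S * (#S : ℝ) ^ 2 / (alphaValue M S : ℝ) ^ 2)) := by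
  set α := alphaValue M S with hαd
  set ℓ := nonCoreMass M S with hℓ
  have hα1 : (1 : ℝ) ≤ α := by exact_mod_cast alphaValue_pos M S
  have hL0 : 0 < L := by linarith
  have hℓ0 : 0 ≤ ℓ := sum_nonneg fun x _ => marginalProb_nonneg M S x
  have hSr : (0 : ℝ) < #S := by nlinarith
  have hnS : (#S : ℝ) ≤ Fintype.card E := by exact_mod_cast card_le_univ S
  have hn0 : (2 : ℝ) ≤ Fintype.card E := by exact_mod_cast hn2
  set n : ℝ := (Fintype.card E : ℝ) with hnd
  have hXS : S \ coreSet M S ⊆ S := sdiff_subset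
  refine CertifiesWhp.mono (τ := 1 / 2 ^ 30 / L ^ 4 * (ℓ * (#S : ℝ) ^ 2 / (α : ℝ) ^ 2)) ?_
    (by gcongr; exact min_le_right _ _)
  rcases le_or_gt (#S : ℝ) (16 * L * α) with hα' | hα'
  · have hratio : (#S : ℝ) ^ 2 / (α : ℝ) ^ 2 ≤ 256 * L ^ 2 := by
      rw [div_le_iff₀ (by positivity)]
      calc (#S : ℝ) ^ 2 ≤ (16 * L * α) ^ 2 := by gcongr
        _ = 256 * L ^ 2 * α ^ 2 := by ring
    have hτ : 1 / 2 ^ 30 / L ^ 4 * (ℓ * (#S : ℝ) ^ 2 / (α : ℝ) ^ 2) ≤ ℓ / (2 ^ 22 * L ^ 2) := by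
      calc 1 / 2 ^ 30 / L ^ 4 * (ℓ * (#S : ℝ) ^ 2 / (α : ℝ) ^ 2)
          = 1 / 2 ^ 30 / L ^ 4 * (ℓ * ((#S : ℝ) ^ 2 / (α : ℝ) ^ 2)) := by ring
        _ ≤ 1 / 2 ^ 30 / L ^ 4 * (ℓ * (256 * L ^ 2)) := by gcongr
        _ = ℓ / (2 ^ 22 * L ^ 2) := by field_simp; ring
    -- If `ℓ ≤ 8` the target is at most 1; otherwise the loss of 4 is at most half of `ℓ`.
    rcases le_or_gt ℓ 8 with h8 | h8
    · refine CertifiesWhp.of_le_one hM hS (by omega) (hτ.trans ?_)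
      rw [div_le_one (by positivity)]
      nlinarith
    · refine CertifiesWhp.of_alphaValue_large hM hS hL hLn hn2 hα hα' hXS (hτ.trans ?_)
      change ℓ / _ ≤ (ℓ - 4) / _
      rw [div_le_div_iff₀ (by positivity) (by positivity)]
      nlinarith [sq_nonneg L]
  -- For such tiny `ℓ` the target is at most 1; otherwise the late circuits, of total weight at most
  -- `n · n⁻⁴`, cost at most `ℓ / 2`.
  · rcases le_or_gt (ℓ * n ^ 3) 2 with h2 | h2
    · refine CertifiesWhp.of_le_one hM hS (by omega) ?_
      have h1 : ℓ * (#S : ℝ) ^ 2 / (α : ℝ) ^ 2 ≤ 1 := by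
        rw [div_le_one (by positivity)]
        have h3 : ℓ * (#S : ℝ) ^ 2 ≤ ℓ * n ^ 2 := by gcongr
        have h4 : ℓ * n ^ 2 * 2 ≤ 2 := by
          calc ℓ * n ^ 2 * 2 ≤ ℓ * n ^ 2 * n := by gcongr
            _ = ℓ * n ^ 3 := by ring
            _ ≤ 2 := h2
        nlinarith
      have h5 : 1 / 2 ^ 30 / L ^ 4 ≤ 1 := by
        rw [div_le_one (by positivity)]
        have : 1 ≤ L ^ 4 := one_le_pow₀ (by linarith)
        linarith
      exact mul_le_one₀ h5 (by positivity) h1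
    · obtain ⟨K, hK0, hK, hu⟩ := exists_prefixIndepProb_le hL hLn hα'
      refine CertifiesWhp.of_alphaValue_small hM hS hL hn2 hα' hXS hK0 hK ?_
      set c := (#S : ℝ) ^ 2 / (200 * L ^ 2 * (α : ℝ) ^ 2) with hc
      have hc0 : 0 ≤ c := by positivity
      have he0 : ∀ x, 0 ≤ earlyProb M S K x := fun x => uniformProb_nonneg _
      have hterm : c * (∑ x ∈ S \ coreSet M S, earlyProb M S K x) / 2 ≤
          ∑ x ∈ S \ coreSet M S, c * earlyProb M S K x / (1 + c * earlyProb M S K x) := by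
        rw [mul_sum, sum_div]
        -- Off the core `c * p ≤ 1 / (200 * L ^ 2)`, so the terms are still in the linear range.
        refine sum_le_sum fun x hx => half_le_div_one_add (mul_nonneg hc0 (he0 x)) ?_
        have hx' : marginalProb M S x < (α : ℝ) ^ 2 / (#S : ℝ) ^ 2 := by
          rw [mem_sdiff, coreSet, mem_filter, not_and, not_le] at hx
          exact hx.2 hx.1
        have h1 : c * earlyProb M S K x ≤ c * ((α : ℝ) ^ 2 / (#S : ℝ) ^ 2) := by
          gcongr; exact (earlyProb_le_marginalProb M S K x).trans hx'.le
        refine h1.trans ?_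
        rw [hc, div_mul_div_comm, div_le_one (by positivity)]
        have : (0 : ℝ) ≤ #S ^ 2 * α ^ 2 := by positivity
        have : (1 : ℝ) ≤ 200 * L ^ 2 := by nlinarith
        nlinarith
      have hu0 : 0 ≤ prefixIndepProb M S K := uniformProb_nonneg _
      have hsum : ℓ / 2 ≤ ∑ x ∈ S \ coreSet M S, earlyProb M S K x := by
        have h1 : ℓ ≤ _ := sum_le_sum fun x (_ : x ∈ S \ coreSet M S) => marginalProb_le M S K x
        rw [sum_add_distrib, sum_const, nsmul_eq_mul] at h1
        have h3 : (#(S \ coreSet M S) : ℝ) ≤ n :=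
          le_trans (by exact_mod_cast card_le_card hXS) hnS
        have h4 : #(S \ coreSet M S) * prefixIndepProb M S K ≤ ℓ / 2 := by
          have hn3 : (0 : ℝ) < n ^ 3 := by positivity
          refine le_of_mul_le_mul_right ?_ hn3
          calc #(S \ coreSet M S) * prefixIndepProb M S K * n ^ 3
              ≤ n * prefixIndepProb M S K * n ^ 3 := by gcongr
            _ = prefixIndepProb M S K * n ^ 4 := by ring
            _ ≤ 1 := hu
            _ ≤ ℓ / 2 * n ^ 3 := by linarith
        linarith
      calc 1 / 2 ^ 30 / L ^ 4 * (ℓ * (#S : ℝ) ^ 2 / (α : ℝ) ^ 2)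
          = c * ℓ * (200 / (2 ^ 30 * L ^ 2)) := by rw [hc]; field_simp
        _ ≤ c * ℓ * (1 / 16) := by
            refine mul_le_mul_of_nonneg_left ?_ (mul_nonneg hc0 hℓ0)
            rw [div_le_div_iff₀ (by positivity) (by norm_num)]
            nlinarith
        _ = c * (ℓ / 2) / 2 / 4 := by ring
        _ ≤ c * (∑ x ∈ S \ coreSet M S, earlyProb M S K x) / 2 / 4 := by gcongr
        _ ≤ _ := by gcongr

/-- If the core contains half of `S`, then about `|S|` redundant elements are certified. -/
theorem CertifiesWhp.of_coreSet (hM : M.E = Set.univ)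
    (hS : ¬ M.Indep (S : Set E)) (hL : 24 ≤ L) (hLn : (2 : ℝ) ^ L = Fintype.card E)
    (hn2 : 2 ≤ Fintype.card E) (hα : L * alphaValue M S < #S)
    (hcore : #S ≤ 2 * #(coreSet M S)) :
    CertifiesWhp M S (1 / 2 ^ 30 / L ^ 4 * #S) := by
  set α := alphaValue M S with hαd
  have hα1 : (1 : ℝ) ≤ α := by exact_mod_cast alphaValue_pos M S
  have hL0 : 0 < L := by linarith
  have hSr : (0 : ℝ) < #S := by nlinarith
  have hnS : (#S : ℝ) ≤ Fintype.card E := by exact_mod_cast card_le_univ S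
  have hn0 : (2 : ℝ) ≤ Fintype.card E := by exact_mod_cast hn2
  set n : ℝ := (Fintype.card E : ℝ) with hnd
  have hXS : coreSet M S ⊆ S := filter_subset _ _
  have hcr : (#S : ℝ) ≤ 2 * #(coreSet M S) := by exact_mod_cast hcore
  have hp : ∀ x ∈ coreSet M S, (α : ℝ) ^ 2 / (#S : ℝ) ^ 2 ≤ marginalProb M S x := fun x hx =>
    (mem_filter.1 hx).2
  have hτeq : 1 / 2 ^ 30 / L ^ 4 * #S = #S / (2 ^ 30 * L ^ 4) := by field_simp
  rw [hτeq]
  rcases le_or_gt (#S : ℝ) (16 * L * α) with hα' | hα'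
  -- Small `S` make the target at most 1; for larger ones the core has marginal sum at least 8, so
  -- subtracting 4 is harmless.
  · rcases le_or_gt (#S : ℝ) (2 ^ 12 * L ^ 2) with h8 | h8
    · refine CertifiesWhp.of_le_one hM hS (by omega) ?_
      rw [div_le_one (by positivity)]
      have : 1 ≤ L ^ 2 := one_le_pow₀ (by linarith)
      nlinarith
    · refine CertifiesWhp.of_alphaValue_large hM hS hL hLn hn2 hα hα' hXS ?_
      have hratio : 1 / (256 * L ^ 2) ≤ (α : ℝ) ^ 2 / (#S : ℝ) ^ 2 := by
        rw [div_le_div_iff₀ (by positivity) (by positivity), one_mul]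
        calc (#S : ℝ) ^ 2 ≤ (16 * L * α) ^ 2 := by gcongr
          _ = α ^ 2 * (256 * L ^ 2) := by ring
      have hsum : #S / (512 * L ^ 2) ≤ ∑ x ∈ coreSet M S, marginalProb M S x := by
        have h1 := sum_le_sum fun x hx => hratio.trans (hp x hx)
        rw [sum_const, nsmul_eq_mul] at h1
        refine le_trans ?_ h1
        rw [mul_one_div, div_le_div_iff₀ (by positivity) (by positivity)]
        nlinarith [mul_le_mul_of_nonneg_right hcr (sq_nonneg L)]
      have h4 : (4 : ℝ) ≤ #S / (1024 * L ^ 2) := by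
        rw [le_div_iff₀ (by positivity)]; linarith
      have h5 : (#S : ℝ) / (512 * L ^ 2) = 2 * (#S / (1024 * L ^ 2)) := by field_simp; norm_num
      calc (#S : ℝ) / (2 ^ 30 * L ^ 4) ≤ #S / (2 ^ 20 * L ^ 4) := by gcongr <;> norm_num
        _ = #S / (1024 * L ^ 2) / (2 ^ 10 * L ^ 2) := by field_simp; norm_num
        _ ≤ _ := by gcongr; linarith
  · obtain ⟨K, hK0, hK, hu⟩ := exists_prefixIndepProb_le hL hLn hα'
    refine CertifiesWhp.of_alphaValue_small hM hS hL hn2 hα' hXS hK0 hK ?_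
    set c := (#S : ℝ) ^ 2 / (200 * L ^ 2 * (α : ℝ) ^ 2) with hc
    have hu0 : 0 ≤ prefixIndepProb M S K := uniformProb_nonneg _
    have hu' : prefixIndepProb M S K ≤ (α : ℝ) ^ 2 / (#S : ℝ) ^ 2 / 2 := by
      rw [div_div, le_div_iff₀ (by positivity)]
      calc prefixIndepProb M S K * ((#S : ℝ) ^ 2 * 2) ≤ prefixIndepProb M S K * (n ^ 2 * n ^ 2) := by
            gcongr
            nlinarith
        _ = prefixIndepProb M S K * n ^ 4 := by ring
        _ ≤ 1 := hu
        _ ≤ α ^ 2 := one_le_pow₀ hα1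
    have hterm : ∀ x ∈ coreSet M S,
        1 / (800 * L ^ 2) ≤ c * earlyProb M S K x / (1 + c * earlyProb M S K x) := by
      intro x hx
      have h1 : (α : ℝ) ^ 2 / (#S : ℝ) ^ 2 / 2 ≤ earlyProb M S K x := by
        have := marginalProb_le M S K x
        have := hp x hx
        linarith
      have h2 : 1 / (400 * L ^ 2) ≤ c * earlyProb M S K x := by
        calc 1 / (400 * L ^ 2) = c * ((α : ℝ) ^ 2 / (#S : ℝ) ^ 2 / 2) := by
              rw [hc]; field_simp; norm_num
          _ ≤ _ := by gcongr
      refine le_trans ?_ (div_one_add_mono (by positivity) h2)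
      refine le_trans (le_of_eq ?_) (half_le_div_one_add (by positivity) ?_)
      · field_simp; norm_num
      · rw [div_le_one (by positivity)]; nlinarith
    have h1 := sum_le_sum hterm
    rw [sum_const, nsmul_eq_mul] at h1
    calc (#S : ℝ) / (2 ^ 30 * L ^ 4) ≤ #S / (6400 * L ^ 2) := by
          refine div_le_div_of_nonneg_left hSr.le (by positivity) ?_
          have : L ^ 2 ≤ L ^ 4 := pow_le_pow_right₀ (by linarith) (by norm_num)
          nlinarith [sq_nonneg L]
      _ = (#S / 2) * (1 / (800 * L ^ 2)) / 4 := by field_simp; norm_num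
      _ ≤ #(coreSet M S) * (1 / (800 * L ^ 2)) / 4 := by gcongr; linarith
      _ ≤ _ := by gcongr

end Regimes

/-! ### The main theorem. -/

theorem lemma4 :
    ∃ (c k n₀ : ℕ) (δ ε : ℝ), 0 < δ ∧ 0 < ε ∧
      ∀ (E : Type) [Fintype E] (S : Finset E), n₀ ≤ Fintype.card E →
        ∃ A : OneRoundAlgorithm E,
          (∀ ω : A.Seed, #(A.queries ω) ≤ Fintype.card E ^ c) ∧
          ∀ M : Matroid E, M.E = Set.univ → GloballyOptimal M S →
            (alphaValue M S : ℝ) / #S < 1 / Real.logb 2 (Fintype.card E) →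
            1 - (2 : ℝ) ^ (-(ε * Fintype.card E)) ≤
              uniformProb A.Seed fun ω =>
                IsRedundantIn M S (A.run M ω) ∧
                δ / Real.logb 2 (Fintype.card E) ^ k *
                    min (#S : ℝ) (nonCoreMass M S * (#S : ℝ) ^ 2 / (alphaValue M S : ℝ) ^ 2)
                  ≤ #(A.run M ω) ∧
                δ / Real.logb 2 (Fintype.card E) ^ k * ((#S : ℝ) / max 1 (nonCoreMass M S))
                  ≤ #(A.run M ω) ∧
                (2 * #(coreSet M S) ≤ #S →
                  δ / Real.logb 2 (Fintype.card E) ^ k * ((#S : ℝ) / nonCoreMass M S)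
                    ≤ #(A.run M ω)) := by
  classical
  -- The exponent 12 counts the queries and `2 ^ 24` ensures `L ≥ 24`. The power `L ^ 4` comes from
  -- `α` near `#S / L`, with `L ^ 2` from the block bound and `L ^ 2` from `#S ^ 2 / α ^ 2`.
  refine ⟨12, 4, 2 ^ 24, 1 / 2 ^ 30, 1 / 2, by norm_num, by norm_num, fun E _ S hn => ?_⟩
  have hn2 : 2 ≤ Fintype.card E := le_trans (by norm_num) hn
  refine ⟨certifyingAlgorithm S, fun ω => card_querySets_le ω hn2, fun M hM hopt hα => ?_⟩
  set L := Real.logb 2 (Fintype.card E) with hLdef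
  have hnr : (2 : ℝ) ^ 24 ≤ Fintype.card E := by exact_mod_cast hn
  have hn0 : (0 : ℝ) < Fintype.card E := by linarith [show (0 : ℝ) < 2 ^ 24 by norm_num]
  have hLn : (2 : ℝ) ^ L = Fintype.card E := Real.rpow_logb (by norm_num) (by norm_num) hn0
  have hL : 24 ≤ L := by
    rw [hLdef, Real.le_logb_iff_rpow_le (by norm_num) hn0]
    exact_mod_cast hn
  have hL0 : 0 < L := by linarith
  have hLle : L ≤ Fintype.card E := by
    rw [hLdef, Real.logb_le_iff_le_rpow (by norm_num) hn0, Real.rpow_natCast]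
    exact_mod_cast Nat.lt_two_pow_self.le
  have hSr : (0 : ℝ) < #S := by exact_mod_cast hopt.card_pos
  have hα' : L * alphaValue M S < #S := by
    rw [div_lt_div_iff₀ hSr hL0] at hα; linarith
  have hS := hopt.not_indep hL0
  have hδ : (0 : ℝ) ≤ 1 / 2 ^ 30 / L ^ 4 := by positivity
  have h1 := CertifiesWhp.of_nonCoreMass hM hS hL hLn hn2 hα'
  -- One target serves both parts of the second bound: of order `#S / ℓ` if the core is at most half
  -- of `S`, of order `#S` otherwise.
  obtain ⟨τ, h2, hτ1, hτ2⟩ : ∃ τ, CertifiesWhp M S τ ∧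
      1 / 2 ^ 30 / L ^ 4 * ((#S : ℝ) / max 1 (nonCoreMass M S)) ≤ τ ∧
      (2 * #(coreSet M S) ≤ #S → 1 / 2 ^ 30 / L ^ 4 * ((#S : ℝ) / nonCoreMass M S) ≤ τ) := by
    by_cases hcore : 2 * #(coreSet M S) ≤ #S
    · have hX : #S ≤ 2 * #(S \ coreSet M S) := by
        have := card_le_card_sdiff_add_card (s := S) (t := coreSet M S)
        omega
      obtain ⟨hℓ, h⟩ := hopt.certifiesWhp_of_half hM hn (by linarith) hLle sdiff_subset hX
      change 0 < nonCoreMass M S at hℓ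
      refine ⟨_, h.mono (τ' := 1 / 2 ^ 30 / L ^ 4 * ((#S : ℝ) / nonCoreMass M S)) ?_, ?_,
        fun _ => le_rfl⟩
      · change _ ≤ (#S : ℝ) / (2 ^ 28 * L * nonCoreMass M S)
        rw [div_div, div_mul_div_comm, one_mul]
        refine div_le_div_of_nonneg_left hSr.le (by positivity) ?_
        gcongr
        · norm_num
        · norm_num
        · exact le_self_pow₀ (by linarith) (by norm_num)
      · gcongr
        exact le_max_right _ _
    · refine ⟨_, CertifiesWhp.of_coreSet hM hS hL hLn hn2 hα' (by omega), ?_,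
        fun h => absurd h hcore⟩
      gcongr
      exact div_le_self hSr.le (le_max_left _ _)
  have hne := orderingBlocks_nonempty (S := S)
  set Q : ℝ → OrderingBlocks S → Prop := fun τ ω =>
    ∃ D, Certified (fun Q => M.Indep (Q : Set E)) (testSets ω) S D ∧ τ ≤ #D with hQ
  have hboth : 1 - 2 * (1 / 2 : ℝ) ^ Fintype.card E ≤ uniformProb (OrderingBlocks S) fun ω =>
      Q (1 / 2 ^ 30 / L ^ 4 * min (#S : ℝ)
        (nonCoreMass M S * (#S : ℝ) ^ 2 / (alphaValue M S : ℝ) ^ 2)) ω ∧ Q τ ω := by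
    have h3 := uniformProb_le_add (fun ω => ¬ (Q (1 / 2 ^ 30 / L ^ 4 * min (#S : ℝ)
      (nonCoreMass M S * (#S : ℝ) ^ 2 / (alphaValue M S : ℝ) ^ 2)) ω ∧ Q τ ω)) _ _
      fun ω h => not_and_or.1 h
    rw [uniformProb_not, uniformProb_not, uniformProb_not] at h3
    rw [CertifiesWhp] at h1 h2
    linarith
  have hε : 2 * (1 / 2 : ℝ) ^ Fintype.card E ≤ 2 ^ (-(1 / 2 * (Fintype.card E : ℝ))) := by
    have : 2 * (1 / 2 : ℝ) ^ Fintype.card E = 2 ^ (1 - (Fintype.card E : ℝ)) := by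
      rw [Real.rpow_sub (by norm_num), Real.rpow_one, Real.rpow_natCast, one_div, inv_pow,
        div_eq_mul_inv]
    rw [this]
    refine Real.rpow_le_rpow_of_exponent_le (by norm_num) ?_
    have : (2 : ℝ) ≤ Fintype.card E := by exact_mod_cast hn2
    linarith
  refine (sub_le_sub_left hε 1).trans (hboth.trans (uniformProb_mono ?_))
  -- The two certified sets may differ; the output is at least as large as each.
  rintro ω ⟨⟨D₁, hD₁, hτD₁⟩, D₂, hD₂, hτD₂⟩
  obtain ⟨hcert, hc₁⟩ := certifyingAlgorithm_run M ω hD₁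
  have hc₂ := (certifyingAlgorithm_run M ω hD₂).2
  have hc₁' : (#D₁ : ℝ) ≤ #((certifyingAlgorithm S).run M ω) := by exact_mod_cast hc₁
  have hc₂' : (#D₂ : ℝ) ≤ #((certifyingAlgorithm S).run M ω) := by exact_mod_cast hc₂
  exact ⟨hcert.isRedundantIn hM, hτD₁.trans hc₁', hτ1.trans (hτD₂.trans hc₂'),
    fun h => (hτ2 h).trans (hτD₂.trans hc₂')⟩
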